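/- Write $\{0,1\}^*$ for the set of finite binary strings, $\mathbf C=\{0,1\}^{\infty}$ for the set of infinite binary sequences, $x\sqsubseteq y$ for "$x$ is a prefix of $y$", $x\sqsubset y$ for "$x\sqsubseteq y$ and $x\ne y$", and $S[0\dots n]$ for the string of the first $n+1$ bits of $S\in\mathbf C$. An \emph{acceptable odds function} is a function $O:\{0,1\}^*\to\mathbb Q\cap[1,2]$ such that $\prod_{w\sqsubset S}O(w)=\infty$ for every $S\in\mathbf C$ (the product is over all finite prefixes $w$ of $S$). An \emph{$O$-supermartingale} is a function $d:\{0,1\}^*\to[0,\infty)$ with $d(w)\ge \frac{d(w0)}{O(w0)}+\frac{d(w1)}{O(w1)}$ for all $w\in\{0,1\}^*$. A set $X\subseteq\mathbf C$ has \emph{computable strong packing dimension zero} if there is a functional $F$, assigning to each acceptable odds function $O$ a function $F(O):\{0,1\}^*\to[0,\infty)$, such that 1. $F$ is computable: there is a single oracle Turing machine that, for every acceptable odds function $O$, every $r\in\mathbb N$ and every $w\in\{0,1\}^*$, on input $(r,w)$ with oracle $O$ halts and outputs a non-negative rational $q$ with $|q-F(O)(w)|\le 2^{-r}$; and 2. for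 every acceptable odds function $O$, $F(O)$ is an $O$-supermartingale and $\liminf_{n\to\infty}F(O)(S[0\dots n])=\infty$ for all $S\in X$. A \emph{weak constructor} is a sequence $\delta=(\delta(n))_{n\in\mathbb N}$ of finite sets $\delta(n)\subseteq\{0,1\}^*$ such that, for some $b\in\mathbb N$, $|\delta(n)|\le b$ for all $n$, and such that for all $n\ge 1$ and all $w\in\delta(n)$ there is a $u\in\delta(n-1)$ with $u\sqsubset w$. Its \emph{result} is $R(\delta)=\{S\in\mathbf C : \forall n\in\mathbb N\ \exists w\in\delta(n)\ w\sqsubseteq S\}$. A set $X\subseteq\mathbf C$ is \emph{weakly computably countable} if there is a computable function $\delta$ that maps each $(k,n)\in\mathbb N\times\mathbb N$ to (a list of the elements of) a finite set $\delta_k(n)\subseteq\{0,1\}^*$, such that every $\delta_k$ is a weak constructor (the bound $b$ may depend on $k$) and $X\subseteq\bigcup_{k\in\mathbb N}R(\delta_k)$. \textbf{Theorem.} A set $X\subseteq\mathbf C$ has computable strong packing dimension zero if and only if it is weakly computably countable. -/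

import Mathlib

namespace StrongPacking

/-! ### Strings and sequences -/

/-- The string consisting of the first `n` bits of the infinite binary sequence `S`. -/
def initSeg (S : ℕ → Bool) (n : ℕ) : List Bool := (List.range n).map S

/-- The string `w` is a prefix of the infinite binary sequence `S`. -/
def IsInitSeg (w : List Bool) (S : ℕ → Bool) : Prop := initSeg S w.length = w

/-- `u` is a proper prefix of `w`. -/
def IsProperPrefix (u w : List Bool) : Prop := u <+: w ∧ u ≠ w

/-! ### Odds functions and supermartingales -/

/-- An acceptable odds function with rational values in `[1, 2]`: along every sequence `S` the
product of the odds of all finite prefixes of `S` diverges to infinity. -/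
structure AcceptableOdds where
  odds : List Bool → ℚ
  one_le : ∀ w, 1 ≤ odds w
  le_two : ∀ w, odds w ≤ 2
  acceptable : ∀ S : ℕ → Bool,
    Filter.Tendsto (fun n => ∏ i ∈ Finset.range n, odds (initSeg S i)) Filter.atTop Filter.atTop

/-- `d : {0,1}* → [0,∞)` is an `O`-supermartingale. -/
def IsSupermartingale (O : List Bool → ℚ) (d : List Bool → ℝ) : Prop :=
  (∀ w, 0 ≤ d w) ∧
  ∀ w, d (w ++ [false]) / (O (w ++ [false]) : ℝ) + d (w ++ [true]) / (O (w ++ [true]) : ℝ) ≤ d w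

/-- The limit inferior of `d (S[0…n])` is infinite. -/
def SucceedsStrongly (d : List Bool → ℝ) (S : ℕ → Bool) : Prop :=
  Filter.liminf (fun n : ℕ => ((d (initSeg S (n + 1)) : ℝ) : EReal)) Filter.atTop = ⊤

/-! ### Oracle computation -/

/-- Programs for partial recursive functions with an oracle: the usual closure operations
(pairing, composition, primitive recursion, unbounded search), together with an instruction that
queries the oracle. -/
inductive OracleProgram : Type
  | zero : OracleProgram
  | succ : OracleProgram
  | left : OracleProgram
  | right : OracleProgram
  | query : OracleProgram
  | pair : OracleProgram → OracleProgram → OracleProgram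
  | comp : OracleProgram → OracleProgram → OracleProgram
  | prec : OracleProgram → OracleProgram → OracleProgram
  | rfind : OracleProgram → OracleProgram

/-- The partial function computed by a program with oracle `o`. A program that does not halt on
an input has the value `Part.none` there. -/
def OracleProgram.eval (o : ℕ → ℕ) : OracleProgram → ℕ →. ℕ
  | .zero => fun _ => Part.some 0
  | .succ => fun n => Part.some (n + 1)
  | .left => fun n => Part.some n.unpair.1
  | .right => fun n => Part.some n.unpair.2
  | .query => fun n => Part.some (o n)
  | .pair f g => fun n => (eval o f n).bind fun a => (eval o g n).map fun b => Nat.pair a b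
  | .comp f g => fun n => (eval o g n).bind (eval o f)
  | .prec f g => fun p =>
      Nat.rec (eval o f p.unpair.1)
        (fun y ih => ih.bind fun i => eval o g (Nat.pair p.unpair.1 (Nat.pair y i))) p.unpair.2
  | .rfind f => fun a =>
      Nat.rfind fun n => (eval o f (Nat.pair a n)).map fun m => decide (m = 0)

/-- The odds function `O` as an oracle on natural numbers: a query that codes the string `w` is
answered by the numerator and the denominator of `O w`. (Numbers that code no string are
answered by `0`.) -/
def AcceptableOdds.oracle (O : AcceptableOdds) (n : ℕ) : ℕ :=
  match (Encodable.decode n : Option (List Bool)) with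
  | some w => Nat.pair (O.odds w).num.natAbs (O.odds w).den
  | none => 0

/-- The non-negative rational number that a natural number denotes as an output: the pair
`(a, b)` denotes `a / (b + 1)`. -/
def ratOfCode (m : ℕ) : ℚ := (m.unpair.1 : ℚ) / ((m.unpair.2 : ℚ) + 1)

/-- A computable functional on the acceptable odds functions: a single oracle program that, for
every acceptable odds function `O`, halts with oracle `O` on all inputs `(r, w)` and outputs a
rational number within `2 ^ (-r)` of `F O w`. -/
def ComputableFunctional (F : AcceptableOdds → List Bool → ℝ) : Prop :=
  ∃ M : OracleProgram, ∀ (O : AcceptableOdds) (r : ℕ) (w : List Bool),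
    ∃ m ∈ M.eval O.oracle (Nat.pair r (Encodable.encode w)),
      |(ratOfCode m : ℝ) - F O w| ≤ (1 / 2 : ℝ) ^ r

/-- The set `X` of sequences has computable strong packing dimension zero. -/
def HasComputableSPDZ (X : Set (ℕ → Bool)) : Prop :=
  ∃ F : AcceptableOdds → List Bool → ℝ, ComputableFunctional F ∧
    ∀ O : AcceptableOdds, IsSupermartingale O.odds (F O) ∧ ∀ S ∈ X, SucceedsStrongly (F O) S

/-! ### Weak constructors -/

/-- A weak constructor: a sequence of finite sets of strings, of bounded cardinality, such that
every string of each set properly extends a string of the preceding set. -/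
def IsWeakConstructor (δ : ℕ → Finset (List Bool)) : Prop :=
  ∃ b : ℕ, (∀ n, (δ n).card ≤ b) ∧
    ∀ n, ∀ w ∈ δ (n + 1), ∃ u ∈ δ n, IsProperPrefix u w

/-- The result of a weak constructor: the sequences with a prefix in each of its sets. -/
def weakResult (δ : ℕ → Finset (List Bool)) : Set (ℕ → Bool) :=
  {S | ∀ n, ∃ w ∈ δ n, IsInitSeg w S}

/-- A family of finite sets of strings is computable: some computable function lists, on input
`(k, n)`, the elements of the set `δ k n`. -/
def ComputableFamily (δ : ℕ → ℕ → Finset (List Bool)) : Prop :=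
  ∃ L : ℕ × ℕ → List (List Bool), Computable L ∧ ∀ k n, (L (k, n)).toFinset = δ k n

/-- The set `X` of sequences is weakly computably countable. -/
def WeaklyComputablyCountable (X : Set (ℕ → Bool)) : Prop :=
  ∃ δ : ℕ → ℕ → Finset (List Bool), ComputableFamily δ ∧
    (∀ k, IsWeakConstructor (δ k)) ∧ X ⊆ ⋃ k, weakResult (δ k)

end StrongPacking

namespace StrongPacking

open Encodable

/-! ### Computable operations on lists -/

section Lists

variable {α β γ σ : Type*} [Primcodable α] [Primcodable β] [Primcodable γ] [Primcodable σ]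

/-! Let `P w` be the product of the odds of all prefixes of `w`. If `d` is a supermartingale, the
sum of `d w / P w` over the strings of one length is at most `d []` (`IsSupermartingale.sum_le`).
Conversely `P w * μ w` is a supermartingale whenever `μ ≥ 0` and `μ (w0) + μ (w1) ≤ μ w`.

From constructors to a functional: by compactness there are levels, computable from the oracle,
beyond which `P` is at least `2 ^ growth i`. Weight `2 ^ (-t)` with `t = pair i (pair k p)` is
placed on the `p`-th string of `δ k (level i)`. A prefix of `S ∈ weakResult (δ k)` of length between
levels `j` and `j + 1` lies below a string of `δ k (level (j + 1))`. The factor `P`, already large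
at level `j`, outweighs the smallness of that string's weight, so the capital is at least `2 ^ j`
(`succeedsStrongly_stake`).

From a functional to constructors: odds 1 and 2 suffice. A condition `p` fixes finitely many odds;
`condBit p n` completes it with odds 1 up to length `n` and 2 afterwards. A string of length `n` is
accepted when the program, run with these odds, outputs at least 1. There `P ≤ 2 ^ |p|`, so the
number of accepted strings is bounded independently of `n` once the initial capital is bounded. If
no `p` accepted all long prefixes of some `S ∈ X`, each rejection could be preserved by a finite
extension of the condition. Iteration would then give acceptable odds for which the capital along
`S` is at most 2 infinitely often (`exists_not_succeedsStrongly`). So `S` is a path of a computable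
tree of bounded width; the pairs `(p, b)` of a condition and a width bound index the required
family. -/

theorem computable_foldl {f : α → List β} {g : α → σ} {h : α → σ × β → σ}
    (hf : Computable f) (hg : Computable g) (hh : Computable₂ h) :
    Computable fun a => (f a).foldl (fun s b => h a (s, b)) (g a) := by
  have key : Computable fun a => Nat.rec (motive := fun _ => σ) (g a)
      (fun n s => (((f a)[n]?).map fun b => h a (s, b)).getD s) (f a).length := by
    refine Computable.nat_rec (Computable.list_length.comp hf) hg
      (h := fun a (p : ℕ × σ) => (((f a)[p.1]?).map fun b => h a (p.2, b)).getD p.2) ?_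
    refine Computable.option_getD (Computable.option_map ?_ ?_)
      (Computable.snd.comp Computable.snd)
    · exact Computable.list_getElem?.comp (hf.comp Computable.fst)
        (Computable.fst.comp Computable.snd)
    · exact hh.comp (Computable.fst.comp Computable.fst)
        (Computable.pair (Computable.snd.comp (Computable.snd.comp Computable.fst))
          Computable.snd)
  refine key.of_eq fun a => ?_
  have aux : ∀ n, n ≤ (f a).length → Nat.rec (motive := fun _ => σ) (g a)
      (fun n s => (((f a)[n]?).map fun b => h a (s, b)).getD s) n =
      ((f a).take n).foldl (fun s b => h a (s, b)) (g a) := by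
    intro n
    induction n with
    | zero => intro _; simp
    | succ n ih =>
      intro hn
      have hn' : n < (f a).length := hn
      rw [List.take_add_one, List.foldl_append, ← ih hn'.le]
      simp [hn']
  rw [aux _ le_rfl, List.take_length]

theorem computable_flatMap {f : α → List β} {g : α → β → List γ}
    (hf : Computable f) (hg : Computable₂ g) : Computable fun a => (f a).flatMap (g a) := by
  refine (computable_foldl (h := fun a (p : List γ × β) => p.1 ++ g a p.2) hf
    (Computable.const []) ?_).of_eq fun a => ?_
  · exact Computable.list_append.comp (Computable.fst.comp Computable.snd)
      (hg.comp Computable.fst (Computable.snd.comp Computable.snd))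
  · have : ∀ (l : List β) (acc : List γ),
        l.foldl (fun s b => s ++ g a b) acc = acc ++ l.flatMap (g a) := by
      intro l
      induction l with
      | nil => simp
      | cons b l ih => intro acc; simp [ih]
    simpa using this (f a) []

theorem computable_filter {f : α → List β} {p : α → β → Bool}
    (hf : Computable f) (hp : Computable₂ p) : Computable fun a => (f a).filter (p a) := by
  refine (computable_flatMap (g := fun a b => bif p a b then [b] else []) hf ?_).of_eq fun a => ?_
  · exact Computable.cond hp
      (Computable.list_cons.comp Computable.snd (Computable.const [])) (Computable.const [])
  · induction f a with
    | nil => rfl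
    | cons b l ih => cases h : p a b <;> simp [h, ih]

theorem computable_sum_map {f : α → List β} {g : α → β → ℕ}
    (hf : Computable f) (hg : Computable₂ g) : Computable fun a => ((f a).map (g a)).sum := by
  refine (computable_foldl (h := fun a (p : ℕ × β) => p.1 + g a p.2) hf
    (Computable.const 0) ?_).of_eq fun a => ?_
  · exact Primrec.nat_add.to_comp.comp (Computable.fst.comp Computable.snd)
      (hg.comp Computable.fst (Computable.snd.comp Computable.snd))
  · have : ∀ (l : List β) (acc : ℕ),
        l.foldl (fun s b => s + g a b) acc = acc + (l.map (g a)).sum := by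
      intro l
      induction l with
      | nil => simp
      | cons b l ih => intro acc; simp [ih, add_assoc]
    simpa using this (f a) 0

theorem computable_prod_map {f : α → List β} {g : α → β → ℕ}
    (hf : Computable f) (hg : Computable₂ g) : Computable fun a => ((f a).map (g a)).prod := by
  refine (computable_foldl (h := fun a (p : ℕ × β) => p.1 * g a p.2) hf
    (Computable.const 1) ?_).of_eq fun a => ?_
  · exact Primrec.nat_mul.to_comp.comp (Computable.fst.comp Computable.snd)
      (hg.comp Computable.fst (Computable.snd.comp Computable.snd))
  · have : ∀ (l : List β) (acc : ℕ),
        l.foldl (fun s b => s * g a b) acc = acc * (l.map (g a)).prod := by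
      intro l
      induction l with
      | nil => simp
      | cons b l ih => intro acc; simp [ih, mul_assoc]
    simpa using this (f a) 1

theorem computable_all {f : α → List β} {p : α → β → Bool}
    (hf : Computable f) (hp : Computable₂ p) : Computable fun a => (f a).all (p a) := by
  refine (computable_foldl (h := fun a (q : Bool × β) => q.1 && p a q.2) hf
    (Computable.const true) ?_).of_eq fun a => ?_
  · exact Primrec.and.to_comp.comp (Computable.fst.comp Computable.snd)
      (hp.comp Computable.fst (Computable.snd.comp Computable.snd))
  · have : ∀ (l : List β) (acc : Bool),
        l.foldl (fun s b => s && p a b) acc = (acc && l.all (p a)) := by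
      intro l
      induction l with
      | nil => simp
      | cons b l ih => intro acc; simp [ih, Bool.and_assoc]
    simpa using this (f a) true

/-- A list with the same elements and no repetitions. -/
def distinct [DecidableEq β] (l : List β) : List β :=
  l.foldl (fun s b => if b ∈ s then s else s ++ [b]) []

theorem computable_distinct [DecidableEq β] : Computable (distinct : List β → List β) := by
  refine (computable_foldl (f := fun l : List β => l)
    (h := fun _ (p : List β × β) => if p.2 ∈ p.1 then p.1 else p.1 ++ [p.2])
    Computable.id (Computable.const []) ?_)
  have hmem : PrimrecPred fun p : List β × β => p.2 ∈ p.1 := by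
    refine (PrimrecRel.exists_mem_list (R := fun a b : β => a = b) Primrec.eq).of_eq ?_
    simp
  have hp : Primrec fun p : List β × β => if p.2 ∈ p.1 then p.1 else p.1 ++ [p.2] :=
    Primrec.ite hmem Primrec.fst (Primrec.list_concat.comp Primrec.fst Primrec.snd)
  exact hp.to_comp.comp Computable.snd

end Lists

theorem distinct_spec {β : Type*} [DecidableEq β] (l : List β) :
    (distinct l).Nodup ∧ (distinct l).toFinset = l.toFinset := by
  have : ∀ (l acc : List β), acc.Nodup →
      (l.foldl (fun s b => if b ∈ s then s else s ++ [b]) acc).Nodup ∧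
      ∀ x, x ∈ l.foldl (fun s b => if b ∈ s then s else s ++ [b]) acc ↔ x ∈ acc ∨ x ∈ l := by
    intro l
    induction l with
    | nil => intro acc h; simpa using h
    | cons b l ih =>
      intro acc h
      rw [List.foldl_cons]
      split_ifs with hb
      · refine ⟨(ih acc h).1, fun x => ?_⟩
        rw [(ih acc h).2 x, List.mem_cons]
        constructor
        · tauto
        · rintro (h | rfl | h) <;> tauto
      · have h' : (acc ++ [b]).Nodup := by
          rw [List.nodup_append]
          refine ⟨h, by simp, ?_⟩
          rintro x hx y hy rfl
          simp only [List.mem_singleton] at hy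
          exact hb (hy ▸ hx)
        refine ⟨(ih _ h').1, fun x => ?_⟩
        rw [(ih _ h').2 x]
        simp [or_assoc]
  refine ⟨(this l [] List.nodup_nil).1, ?_⟩
  ext x
  rw [List.mem_toFinset, List.mem_toFinset, distinct, (this l [] List.nodup_nil).2 x]
  simp

/-! ### Oracle programs -/

namespace OracleProgram

/-- The computation of the program `M` with oracle `o` on the input `n`. -/
def run (M : OracleProgram) (o : ℕ → ℕ) (n : ℕ) : Part ℕ := M.eval o n

theorem run_query (o n) : run .query o n = Part.some (o n) := rfl

theorem run_pair (f g : OracleProgram) (o n) : run (.pair f g) o n =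
    (f.run o n).bind fun a => (g.run o n).map fun b => Nat.pair a b := rfl

theorem run_comp (f g : OracleProgram) (o n) : run (.comp f g) o n =
    (g.run o n).bind fun a => f.run o a := rfl

theorem run_prec (f g : OracleProgram) (o p) : run (.prec f g) o p =
    Nat.rec (motive := fun _ => Part ℕ) (f.run o p.unpair.1)
      (fun y ih => ih.bind fun i => g.run o (Nat.pair p.unpair.1 (Nat.pair y i))) p.unpair.2 := rfl

theorem run_rfind (f : OracleProgram) (o a) : run (.rfind f) o a =
    Nat.rfind fun n => (f.run o (Nat.pair a n)).map fun m => decide (m = 0) := rfl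

theorem mem_rfind_map {f : ℕ → Part ℕ} {y : ℕ} :
    y ∈ (Nat.rfind fun n => (f n).map fun m => decide (m = 0)) ↔
      0 ∈ f y ∧ ∀ m < y, ∃ a ∈ f m, a ≠ 0 := by
  refine Nat.mem_rfind.trans ?_
  have : ∀ (b : Bool) (n : ℕ), (b ∈ (f n).map fun m => decide (m = 0)) ↔
      ∃ a ∈ f n, decide (a = 0) = b := fun b n => Part.mem_map_iff _
  refine and_congr ?_ (forall_congr' fun m => imp_congr_right fun _ => ?_)
  · refine (this _ _).trans ?_
    simp
  · refine (this _ _).trans ?_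
    simp

/-- Use principle: a halting computation asks only finitely many queries. -/
theorem mem_run_of_agree (M : OracleProgram) {o : ℕ → ℕ} : ∀ {x y : ℕ}, y ∈ M.run o x →
    ∃ s, ∀ o' : ℕ → ℕ, (∀ c < s, o' c = o c) → y ∈ M.run o' x := by
  induction M with
  | zero => exact fun h => ⟨0, fun _ _ => h⟩
  | succ => exact fun h => ⟨0, fun _ _ => h⟩
  | left => exact fun h => ⟨0, fun _ _ => h⟩
  | right => exact fun h => ⟨0, fun _ _ => h⟩
  | query =>
    intro x y h
    refine ⟨x + 1, fun o' ho' => ?_⟩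
    simp only [run_query, Part.mem_some_iff] at h ⊢
    rw [h, ho' x (Nat.lt_succ_self x)]
  | pair f g hf hg =>
    intro x y h
    simp only [run_pair, Part.mem_bind_iff, Part.mem_map_iff] at h ⊢
    obtain ⟨a, ha, b, hb, rfl⟩ := h
    obtain ⟨s, hs⟩ := hf ha
    obtain ⟨t, ht⟩ := hg hb
    exact ⟨max s t, fun o' ho' => ⟨a, hs o' fun c hc => ho' c (lt_max_of_lt_left hc),
      b, ht o' fun c hc => ho' c (lt_max_of_lt_right hc), rfl⟩⟩
  | comp f g hf hg =>
    intro x y h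
    simp only [run_comp, Part.mem_bind_iff] at h ⊢
    obtain ⟨a, ha, hb⟩ := h
    obtain ⟨s, hs⟩ := hg ha
    obtain ⟨t, ht⟩ := hf hb
    exact ⟨max s t, fun o' ho' => ⟨a, hs o' fun c hc => ho' c (lt_max_of_lt_left hc),
      ht o' fun c hc => ho' c (lt_max_of_lt_right hc)⟩⟩
  | prec f g hf hg =>
    intro x y h
    simp only [run_prec] at h ⊢
    generalize x.unpair.2 = n at h ⊢
    induction n generalizing y with
    | zero => exact hf h
    | succ n ih =>
      simp only [Part.mem_bind_iff] at h ⊢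
      obtain ⟨a, ha, hb⟩ := h
      obtain ⟨s, hs⟩ := ih ha
      obtain ⟨t, ht⟩ := hg hb
      exact ⟨max s t, fun o' ho' => ⟨a, hs o' fun c hc => ho' c (lt_max_of_lt_left hc),
        ht o' fun c hc => ho' c (lt_max_of_lt_right hc)⟩⟩
  | rfind f hf =>
    intro x y h
    rw [run_rfind] at h
    obtain ⟨ha, hb⟩ := mem_rfind_map.1 h
    obtain ⟨s, hs⟩ := hf ha
    have hex : ∀ m, ∃ t, m < y → ∀ o' : ℕ → ℕ, (∀ c < t, o' c = o c) →
        ∃ a ∈ f.run o' (Nat.pair x m), a ≠ 0 := by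
      intro m
      by_cases hm : m < y
      · obtain ⟨b, hb1, hb2⟩ := hb m hm
        obtain ⟨t, ht⟩ := hf hb1
        exact ⟨t, fun _ o' ho' => ⟨b, ht o' ho', hb2⟩⟩
      · exact ⟨0, fun h => absurd h hm⟩
    choose t ht using hex
    refine ⟨max s ((Finset.range y).sup t), fun o' ho' => ?_⟩
    rw [run_rfind]
    refine mem_rfind_map.2 ⟨hs o' fun c hc => ho' c (lt_max_of_lt_left hc),
      fun m hm => ht m hm o' fun c hc => ho' c (lt_max_of_lt_right (hc.trans_le ?_))⟩
    exact Finset.le_sup (f := t) (Finset.mem_range.2 hm)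

/-- The parameter `a` keeps the simulation uniform in the oracle; the converse direction runs it on
a computable family of oracles indexed by a condition and a length. -/
theorem partrec_run {α : Type*} [Primcodable α] {o : α → ℕ → ℕ} (ho : Computable₂ o)
    (M : OracleProgram) : Partrec₂ fun a x => M.run (o a) x := by
  induction M with
  | zero => exact (Computable.const 0).partrec
  | succ => exact (Computable.succ.comp Computable.snd).partrec
  | left => exact (Computable.fst.comp (Computable.unpair.comp Computable.snd)).partrec
  | right => exact (Computable.snd.comp (Computable.unpair.comp Computable.snd)).partrec
  | query => exact Computable.partrec ho
  | pair f g hf hg =>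
    simp only [run_pair]
    refine Partrec.bind hf (Partrec.map (hg.comp (Computable.fst.comp Computable.fst)
      (Computable.snd.comp Computable.fst)) ?_)
    exact Primrec₂.natPair.to_comp.comp (Computable.snd.comp Computable.fst) Computable.snd
  | comp f g hf hg =>
    simp only [run_comp]
    exact Partrec.bind hg (hf.comp (Computable.fst.comp Computable.fst) Computable.snd)
  | prec f g hf hg =>
    simp only [run_prec]
    have h2 : Computable fun p : α × ℕ => p.2.unpair.1 :=
      Computable.fst.comp (Computable.unpair.comp Computable.snd)
    refine Partrec.nat_rec (f := fun p : α × ℕ => p.2.unpair.2)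
      (g := fun p : α × ℕ => f.run (o p.1) p.2.unpair.1)
      (h := fun (p : α × ℕ) (q : ℕ × ℕ) =>
        g.run (o p.1) (Nat.pair p.2.unpair.1 (Nat.pair q.1 q.2))) ?_ ?_ ?_
    · exact Computable.snd.comp (Computable.unpair.comp Computable.snd)
    · exact hf.comp Computable.fst h2
    · exact hg.comp (Computable.fst.comp Computable.fst)
        (Primrec₂.natPair.to_comp.comp (h2.comp Computable.fst)
          (Primrec₂.natPair.to_comp.comp (Computable.fst.comp Computable.snd)
            (Computable.snd.comp Computable.snd)))
  | rfind f hf =>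
    simp only [run_rfind]
    refine Partrec.rfind (p := fun (q : α × ℕ) n =>
      (f.run (o q.1) (Nat.pair q.2 n)).map fun m => decide (m = 0)) ?_
    refine Partrec.map (hf.comp (Computable.fst.comp Computable.fst)
      (Primrec₂.natPair.to_comp.comp (Computable.snd.comp Computable.fst) Computable.snd)) ?_
    have : Primrec fun n : ℕ => decide (n = 0) :=
      (Primrec.eq.comp Primrec.id (Primrec.const 0)).decide
    exact this.to_comp.comp Computable.snd

theorem exists_run_eq {f : ℕ →. ℕ} (hf : Nat.Partrec f) :
    ∃ M : OracleProgram, ∀ o n, M.run o n = f n := by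
  induction hf with
  | zero => exact ⟨.zero, fun _ _ => rfl⟩
  | succ => exact ⟨.succ, fun _ _ => rfl⟩
  | left => exact ⟨.left, fun _ _ => rfl⟩
  | right => exact ⟨.right, fun _ _ => rfl⟩
  | pair _ _ hf hg =>
    obtain ⟨M, hM⟩ := hf
    obtain ⟨N, hN⟩ := hg
    refine ⟨.pair M N, fun o n => ?_⟩
    simp [run_pair, hM o, hN o, Seq.seq, Part.bind_map]
  | comp _ _ hf hg =>
    obtain ⟨M, hM⟩ := hf
    obtain ⟨N, hN⟩ := hg
    refine ⟨.comp M N, fun o n => ?_⟩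
    simp only [run_comp, hM o, hN o]
    rfl
  | prec _ _ hf hg =>
    obtain ⟨M, hM⟩ := hf
    obtain ⟨N, hN⟩ := hg
    refine ⟨.prec M N, fun o n => ?_⟩
    simp only [run_prec, hM o, hN o]
    rfl
  | rfind _ hf =>
    obtain ⟨M, hM⟩ := hf
    refine ⟨.rfind M, fun o n => ?_⟩
    simp only [run_rfind, hM o]
    rfl

end OracleProgram

/-- The functional `f` is computed by an oracle program that halts with every oracle in `A`. -/
def OracleComputable {α β : Type*} [Primcodable α] [Primcodable β] (A : Set (ℕ → ℕ))
    (f : (ℕ → ℕ) → α → β) : Prop :=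
  ∃ M : OracleProgram, ∀ o ∈ A, ∀ a, M.run o (encode a) = Part.some (encode (f o a))

namespace OracleComputable

variable {α β γ : Type*} [Primcodable α] [Primcodable β] [Primcodable γ] {A : Set (ℕ → ℕ)}

theorem of_computable {g : α → β} (hg : Computable g) : OracleComputable A fun _ => g := by
  obtain ⟨M, hM⟩ := OracleProgram.exists_run_eq hg
  refine ⟨M, fun o _ a => ?_⟩
  rw [hM o]
  simp

theorem query : OracleComputable A fun o (n : ℕ) => o n := ⟨.query, fun _ _ _ => rfl⟩

theorem pair {f : (ℕ → ℕ) → α → β} {g : (ℕ → ℕ) → α → γ} (hf : OracleComputable A f)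
    (hg : OracleComputable A g) : OracleComputable A fun o a => (f o a, g o a) := by
  obtain ⟨M, hM⟩ := hf
  obtain ⟨N, hN⟩ := hg
  refine ⟨.pair M N, fun o ho a => ?_⟩
  simp [OracleProgram.run_pair, hM o ho a, hN o ho a]

theorem comp {f : (ℕ → ℕ) → β → γ} {g : (ℕ → ℕ) → α → β} (hf : OracleComputable A f)
    (hg : OracleComputable A g) : OracleComputable A fun o a => f o (g o a) := by
  obtain ⟨M, hM⟩ := hf
  obtain ⟨N, hN⟩ := hg
  refine ⟨.comp M N, fun o ho a => ?_⟩
  simp [OracleProgram.run_comp, hM o ho, hN o ho]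

theorem table {f : (ℕ → ℕ) → ℕ → β} (hf : OracleComputable A f) :
    OracleComputable A fun o n => (List.range n).map (f o) := by
  obtain ⟨Z, hZ⟩ := of_computable (A := A) (Computable.const (α := ℕ) ([] : List β))
  have hstep : OracleComputable A fun o (p : ℕ × ℕ × List β) => p.2.2 ++ [f o p.2.1] :=
    comp (of_computable (g := fun q : List β × β => q.1 ++ [q.2]) Computable.list_concat)
      (pair (of_computable (Computable.snd.comp Computable.snd))
        (comp hf (of_computable (Computable.fst.comp Computable.snd))))
  obtain ⟨N, hN⟩ := hstep
  -- `prec` expects a parameter paired with the recursion bound; the parameter 0 is a dummy.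
  obtain ⟨Q, hQ⟩ := of_computable (A := A) (g := fun n : ℕ => ((0, n) : ℕ × ℕ))
    (Computable.pair (Computable.const 0) Computable.id)
  refine ⟨.comp (.prec Z N) Q, fun o ho n => ?_⟩
  have hQ' : Q.run o n = Part.some (Nat.pair 0 n) := by simpa using hQ o ho n
  rw [encode_nat, OracleProgram.run_comp, hQ', Part.bind_some, OracleProgram.run_prec,
    Nat.unpair_pair]
  clear hQ'
  induction n with
  | zero => simpa using hZ o ho 0
  | succ n ih =>
    dsimp only at ih ⊢
    rw [ih, Part.bind_some]
    have := hN o ho (0, n, (List.range n).map (f o))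
    simp only [Encodable.encode_prod_val, encode_nat] at this
    rw [this, List.range_succ, List.map_append, List.map_singleton]

theorem find {p : (ℕ → ℕ) → α × ℕ → Bool} (hp : OracleComputable A p)
    (h : ∀ o ∈ A, ∀ a, ∃ n, p o (a, n) = true) :
    OracleComputable A fun o a => sInf {n | p o (a, n) = true} := by
  -- `rfind` searches for the value 0, so truth is coded by 0.
  have h1 : OracleComputable A fun o q => if p o q = true then 0 else 1 := by
    refine comp (of_computable (g := fun b : Bool => if b = true then 0 else 1) ?_) hp
    exact (Primrec.dom_finite _).to_comp
  obtain ⟨N, hN⟩ := h1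
  refine ⟨.rfind N, fun o ho a => ?_⟩
  have hN' : ∀ n, N.run o (Nat.pair (encode a) n) =
      Part.some (if p o (a, n) = true then 0 else 1) := fun n => by
    simpa using hN o ho (a, n)
  rw [Part.eq_some_iff, OracleProgram.run_rfind]
  refine OracleProgram.mem_rfind_map.2 ⟨?_, fun m hm => ?_⟩
  · have := Nat.sInf_mem (s := {n | p o (a, n) = true}) (h o ho a)
    simp only [Set.mem_ofPred_eq] at this
    simp [hN', this]
  · have := Nat.notMem_of_lt_sInf (s := {n | p o (a, n) = true}) hm
    simp only [Set.mem_ofPred_eq] at this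
    simp [hN', this]

end OracleComputable

/-! ### Strings -/

/-- The list of all strings of length `n`. -/
def strs (n : ℕ) : List (List Bool) :=
  Nat.rec [[]] (fun _ l => l.flatMap fun w => [w ++ [false], w ++ [true]]) n

theorem strs_succ (n : ℕ) :
    strs (n + 1) = (strs n).flatMap fun w => [w ++ [false], w ++ [true]] := rfl

theorem primrec_children :
    Primrec fun w : List Bool => [w ++ [false], w ++ [true]] := by
  have h (b : Bool) : Primrec fun w : List Bool => w ++ [b] :=
    Primrec.list_concat.comp Primrec.id (Primrec.const b)
  exact Primrec.list_cons.comp (h false) (Primrec.list_cons.comp (h true) (Primrec.const []))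

theorem primrec_strs : Primrec strs := by
  refine Primrec.nat_rec₁ _ ?_
  exact Primrec.list_flatMap Primrec.snd (primrec_children.comp Primrec.snd)

theorem mem_strs {n : ℕ} {w : List Bool} : w ∈ strs n ↔ w.length = n := by
  induction n generalizing w with
  | zero => simp [strs]
  | succ n ih =>
    rw [strs_succ, List.mem_flatMap]
    constructor
    · rintro ⟨u, hu, hw⟩
      have := ih.1 hu
      simp only [List.mem_cons, List.not_mem_nil, or_false] at hw
      rcases hw with rfl | rfl <;> simp [this]
    · intro hw
      have hne : w ≠ [] := by rintro rfl; simp at hw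
      refine ⟨w.dropLast, ih.2 (by simp [hw]), ?_⟩
      rw [← List.dropLast_append_getLast hne]
      cases w.getLast hne <;> simp

@[simp] theorem length_initSeg (S : ℕ → Bool) (n : ℕ) : (initSeg S n).length = n := by
  simp [initSeg]

theorem take_initSeg (S : ℕ → Bool) {m n : ℕ} (h : m ≤ n) :
    (initSeg S n).take m = initSeg S m := by
  simp [initSeg, ← List.map_take, List.take_range, h]

theorem initSeg_prefix (S : ℕ → Bool) {m n : ℕ} (h : m ≤ n) : initSeg S m <+: initSeg S n := by
  rw [← take_initSeg S h]
  exact List.take_prefix _ _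

theorem initSeg_succ (S : ℕ → Bool) (n : ℕ) : initSeg S (n + 1) = initSeg S n ++ [S n] := by
  simp [initSeg, List.range_succ]

theorem initSeg_succ_mem (S : ℕ → Bool) (n : ℕ) :
    initSeg S (n + 1) ∈ [initSeg S n ++ [false], initSeg S n ++ [true]] := by
  rw [initSeg_succ]
  cases S n <;> simp

/-! ### Codes of strings and of their prefixes -/

theorem length_le_encode (w : List Bool) : w.length ≤ encode w := by
  induction w with
  | nil => simp
  | cons b w ih =>
    rw [List.length_cons, Encodable.encode_list_cons]
    exact Nat.succ_le_succ (ih.trans (Nat.right_le_pair _ _))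

/-- Hence the first `encode w + 1` oracle answers contain all the odds that enter `oddsProd _ w`. -/
theorem encode_le_of_prefix {u w : List Bool} (h : u <+: w) : encode u ≤ encode w := by
  induction u generalizing w with
  | nil => simp
  | cons b u ih =>
    obtain ⟨v, rfl⟩ := h
    rw [List.cons_append, Encodable.encode_list_cons, Encodable.encode_list_cons]
    refine Nat.succ_le_succ ?_
    rcases (ih (List.prefix_append u v)).eq_or_lt with h | h
    · rw [h]
    · exact (Nat.pair_lt_pair_right _ h).le

/-! ### Products of odds -/

/-- The product of the odds of all prefixes of `w`, including `w` itself. -/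
def oddsProd (o : List Bool → ℚ) (w : List Bool) : ℚ :=
  ∏ i ∈ Finset.range (w.length + 1), o (w.take i)

theorem oddsProd_append (o : List Bool → ℚ) (w : List Bool) (b : Bool) :
    oddsProd o (w ++ [b]) = oddsProd o w * o (w ++ [b]) := by
  rw [oddsProd, List.length_append, List.length_singleton, Finset.prod_range_succ]
  congr 1
  · refine Finset.prod_congr rfl fun i hi => ?_
    rw [List.take_append_of_le_length (Nat.lt_succ_iff.1 (Finset.mem_range.1 hi))]
  · rw [List.take_of_length_le (by simp)]

theorem oddsProd_initSeg (o : List Bool → ℚ) (S : ℕ → Bool) (n : ℕ) :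
    oddsProd o (initSeg S n) = ∏ i ∈ Finset.range (n + 1), o (initSeg S i) := by
  rw [oddsProd, length_initSeg]
  refine Finset.prod_congr rfl fun i hi => ?_
  rw [take_initSeg S (Nat.lt_succ_iff.1 (Finset.mem_range.1 hi))]

theorem one_le_oddsProd {o : List Bool → ℚ} (h : ∀ w, 1 ≤ o w) (w : List Bool) :
    1 ≤ oddsProd o w := by
  rw [oddsProd, ← Finset.prod_const_one (s := Finset.range (w.length + 1))]
  exact Finset.prod_le_prod (fun _ _ => zero_le_one) fun _ _ => h _

theorem oddsProd_pos {o : List Bool → ℚ} (h : ∀ w, 1 ≤ o w) (w : List Bool) :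
    0 < oddsProd o w := zero_lt_one.trans_le (one_le_oddsProd h w)

theorem oddsProd_le_of_prefix {o : List Bool → ℚ} (h : ∀ w, 1 ≤ o w) {u w : List Bool}
    (huw : u <+: w) : oddsProd o u ≤ oddsProd o w := by
  obtain ⟨v, rfl⟩ := huw
  induction v using List.reverseRecOn with
  | nil => simp
  | append_singleton v b ih =>
    rw [← List.append_assoc, oddsProd_append]
    exact ih.trans (le_mul_of_one_le_right (oddsProd_pos h _).le (h _))

theorem oddsProd_le_two_pow {o : List Bool → ℚ} (h : ∀ w, 1 ≤ o w) (h2 : ∀ w, o w ≤ 2)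
    (w : List Bool) : oddsProd o w ≤ 2 ^ (w.length + 1) := by
  have := Finset.prod_le_prod (s := Finset.range (w.length + 1)) (f := fun i => o (w.take i))
    (g := fun _ => (2 : ℚ)) (fun _ _ => zero_le_one.trans (h _)) fun _ _ => h2 _
  rwa [Finset.prod_const, Finset.card_range] at this

theorem oddsProd_le_oddsProd {o o' : List Bool → ℚ} (h : ∀ w, 1 ≤ o w) (w : List Bool)
    (h' : ∀ u, u <+: w → o u ≤ o' u) : oddsProd o w ≤ oddsProd o' w :=
  Finset.prod_le_prod (fun _ _ => zero_le_one.trans (h _)) fun _ _ => h' _ (List.take_prefix _ _)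

/-- Compactness of Cantor space: the sets of sequences whose product has reached `C` by length `n`
are open, increase with `n` and cover the space, so one of them is everything. -/
theorem exists_le_oddsProd (O : AcceptableOdds) (C : ℚ) :
    ∃ l, ∀ w : List Bool, w.length = l → C ≤ oddsProd O.odds w := by
  have hopen : ∀ n, IsOpen {S : ℕ → Bool | C ≤ oddsProd O.odds (initSeg S n)} := by
    intro n
    have hc : Continuous fun (S : ℕ → Bool) (i : Fin n) => S i :=
      continuous_pi fun i => continuous_apply _
    have : {S : ℕ → Bool | C ≤ oddsProd O.odds (initSeg S n)} =
        (fun (S : ℕ → Bool) (i : Fin n) => S i) ⁻¹'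
          {f | C ≤ oddsProd O.odds (List.ofFn f)} := by
      ext S
      have : initSeg S n = List.ofFn fun i : Fin n => S i := by
        simp [initSeg, List.ofFn_eq_map, ← List.map_coe_finRange_eq_range]
      simp [this]
    rw [this]
    exact (isOpen_discrete _).preimage hc
  have hmono : Monotone fun n => {S : ℕ → Bool | C ≤ oddsProd O.odds (initSeg S n)} :=
    fun m n hmn S hS => le_trans hS (oddsProd_le_of_prefix O.one_le (initSeg_prefix S hmn))
  obtain ⟨l, hl⟩ := isCompact_univ.elim_directed_cover _ hopen (fun S _ => by
    obtain ⟨n, hn⟩ := ((O.acceptable S).comp (Filter.tendsto_add_atTop_nat 1)).eventually_ge_atTop C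
      |>.exists
    refine Set.mem_iUnion.2 ⟨n, ?_⟩
    simpa [oddsProd_initSeg] using hn) hmono.directed_le
  refine ⟨l, fun w hw => ?_⟩
  have h := hl (Set.mem_univ fun i => w.getD i false)
  have hw' : initSeg (fun i => w.getD i false) l = w := by
    apply List.ext_getElem (by simp [hw])
    intro i h1 h2
    simp [initSeg, h2]
  rwa [Set.mem_ofPred_eq, hw'] at h

/-! ### Supermartingales -/

theorem isSupermartingale_oddsProd_mul {o : List Bool → ℚ} (h : ∀ w, 1 ≤ o w)
    {μ : List Bool → ℝ} (h0 : ∀ w, 0 ≤ μ w)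
    (hμ : ∀ w, μ (w ++ [false]) + μ (w ++ [true]) ≤ μ w) :
    IsSupermartingale o fun w => (oddsProd o w : ℝ) * μ w := by
  have hP : ∀ w, (0 : ℝ) < oddsProd o w := fun w => by exact_mod_cast oddsProd_pos h w
  have ho : ∀ w, (0 : ℝ) < o w := fun w => by exact_mod_cast zero_lt_one.trans_le (h w)
  refine ⟨fun w => mul_nonneg (hP w).le (h0 w), fun w => ?_⟩
  have : ∀ b, (oddsProd o (w ++ [b]) : ℝ) * μ (w ++ [b]) / o (w ++ [b]) =
      oddsProd o w * μ (w ++ [b]) := fun b => by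
    rw [oddsProd_append]
    push_cast
    field_simp [(ho (w ++ [b])).ne']
  rw [this, this, ← mul_add]
  exact mul_le_mul_of_nonneg_left (hμ w) (hP w).le

/-- Dividing by the product of odds turns the supermartingale inequality into subadditivity at each
node. At the root there is only an inequality, because the product includes the odds of the empty
string. -/
theorem IsSupermartingale.sum_le {o : List Bool → ℚ} (h : ∀ w, 1 ≤ o w) {d : List Bool → ℝ}
    (hd : IsSupermartingale o d) (n : ℕ) :
    ((strs n).map fun w => d w / oddsProd o w).sum ≤ d [] := by
  have hP : ∀ w, (0 : ℝ) < oddsProd o w := fun w => by exact_mod_cast oddsProd_pos h w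
  have hstep : ∀ l : List (List Bool),
      ((l.flatMap fun w => [w ++ [false], w ++ [true]]).map fun w => d w / oddsProd o w).sum ≤
        (l.map fun w => d w / oddsProd o w).sum := by
    intro l
    induction l with
    | nil => simp
    | cons w l ih =>
      have : ∀ b, d (w ++ [b]) / (oddsProd o (w ++ [b]) : ℝ) =
          d (w ++ [b]) / o (w ++ [b]) / oddsProd o w := fun b => by
        rw [oddsProd_append]
        push_cast
        rw [div_div, mul_comm]
      have hw : d (w ++ [false]) / (oddsProd o (w ++ [false]) : ℝ) +
          d (w ++ [true]) / (oddsProd o (w ++ [true]) : ℝ) ≤ d w / oddsProd o w := by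
        rw [this, this, ← add_div]
        exact div_le_div_of_nonneg_right (hd.2 w) (hP w).le
      simp only [List.flatMap_cons, List.map_append, List.map_cons, List.map_nil, List.sum_append,
        List.sum_cons, List.sum_nil, add_zero]
      linarith
  induction n with
  | zero =>
    have : (1 : ℝ) ≤ oddsProd o [] := by exact_mod_cast one_le_oddsProd h []
    simpa [strs] using div_le_self (hd.1 []) this
  | succ n ih => exact (hstep _).trans ih

theorem succeedsStrongly_iff {d : List Bool → ℝ} {S : ℕ → Bool} :
    SucceedsStrongly d S ↔ ∀ C : ℝ, ∀ᶠ n in Filter.atTop, C ≤ d (initSeg S n) := by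
  have hshift : (∀ C : ℝ, ∀ᶠ n in Filter.atTop, C ≤ d (initSeg S n)) ↔
      ∀ C : ℝ, ∀ᶠ n in Filter.atTop, C ≤ d (initSeg S (n + 1)) := by
    refine forall_congr' fun C => ?_
    rw [← Filter.map_add_atTop_eq_nat 1, Filter.eventually_map]
    rw [Filter.map_add_atTop_eq_nat 1]
  rw [hshift, SucceedsStrongly]
  constructor
  · intro h C
    have : (C : EReal) < Filter.liminf (fun n : ℕ => ((d (initSeg S (n + 1)) : ℝ) : EReal))
        Filter.atTop := by rw [h]; exact EReal.coe_lt_top C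
    filter_upwards [Filter.eventually_lt_of_lt_liminf this] with n hn
    exact_mod_cast hn.le
  · intro h
    rw [EReal.eq_top_iff_forall_lt]
    intro C
    refine (EReal.coe_lt_coe_iff.2 (lt_add_one C)).trans_le ?_
    refine Filter.le_liminf_of_le (by isBoundedDefault) ?_
    filter_upwards [h (C + 1)] with n hn
    exact_mod_cast hn

/-! ### Reading odds from an oracle table -/

/-- The entry of the string `u` in a table of oracle answers; strings outside of the table have
odds `1`. -/
def entry (σ : List ℕ) (u : List Bool) : ℕ := (σ[encode u]?).getD (Nat.pair 1 1)

def entryOdds (σ : List ℕ) (u : List Bool) : ℚ :=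
  ((entry σ u).unpair.1 : ℚ) / ((entry σ u).unpair.2 : ℚ)

def numProd (σ : List ℕ) (w : List Bool) : ℕ :=
  ((List.range (w.length + 1)).map fun i => (entry σ (w.take i)).unpair.1).prod

def denProd (σ : List ℕ) (w : List Bool) : ℕ :=
  ((List.range (w.length + 1)).map fun i => (entry σ (w.take i)).unpair.2).prod

/-- The table of the first `s` answers of the oracle `o`. -/
def oracleTable (o : ℕ → ℕ) (s : ℕ) : List ℕ := (List.range s).map o

theorem prod_map_range (f : ℕ → ℕ) (n : ℕ) :
    ((List.range n).map f).prod = ∏ i ∈ Finset.range n, f i := by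
  induction n with
  | zero => simp
  | succ n ih => rw [List.prod_range_succ, Finset.prod_range_succ, ih]

theorem oddsProd_entryOdds (σ : List ℕ) (w : List Bool) :
    oddsProd (entryOdds σ) w = (numProd σ w : ℚ) / (denProd σ w : ℚ) := by
  simp only [oddsProd, entryOdds, numProd, denProd, prod_map_range, Finset.prod_div_distrib]
  push_cast
  rfl

theorem AcceptableOdds.oracle_encode (O : AcceptableOdds) (u : List Bool) :
    O.oracle (encode u) = Nat.pair (O.odds u).num.natAbs (O.odds u).den := by
  simp [AcceptableOdds.oracle]

theorem entry_oracleTable (O : AcceptableOdds) (s : ℕ) (u : List Bool) :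
    entry (oracleTable O.oracle s) u =
      if encode u < s then Nat.pair (O.odds u).num.natAbs (O.odds u).den else Nat.pair 1 1 := by
  split_ifs with h
  · simp [entry, oracleTable, h, O.oracle_encode]
  · simp [entry, oracleTable, not_lt.1 h]

theorem entryOdds_oracleTable (O : AcceptableOdds) (s : ℕ) (u : List Bool) :
    entryOdds (oracleTable O.oracle s) u = if encode u < s then O.odds u else 1 := by
  rw [entryOdds, entry_oracleTable]
  split_ifs with h
  · have hpos : 0 < (O.odds u).num := Rat.num_pos.2 (zero_lt_one.trans_le (O.one_le u))
    rw [Nat.unpair_pair]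
    have : ((O.odds u).num.natAbs : ℚ) = (O.odds u).num := by
      rw [Nat.cast_natAbs, abs_of_pos hpos]
    rw [this, Rat.num_div_den]
  · simp

theorem one_le_entryOdds (O : AcceptableOdds) (s : ℕ) (u : List Bool) :
    1 ≤ entryOdds (oracleTable O.oracle s) u := by
  rw [entryOdds_oracleTable]
  split_ifs
  · exact O.one_le u
  · exact le_rfl

/-- Replacing unknown odds by 1 never overestimates a product, so a test passed on a finite table is
valid for the true odds. -/
theorem oddsProd_entryOdds_le (O : AcceptableOdds) (s : ℕ) (w : List Bool) :
    oddsProd (entryOdds (oracleTable O.oracle s)) w ≤ oddsProd O.odds w := by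
  refine oddsProd_le_oddsProd (one_le_entryOdds O s) w fun u _ => ?_
  rw [entryOdds_oracleTable]
  split_ifs
  · exact le_rfl
  · exact O.one_le u

theorem oddsProd_le_entryOdds (O : AcceptableOdds) {s : ℕ} {w : List Bool} (h : encode w < s) :
    oddsProd O.odds w ≤ oddsProd (entryOdds (oracleTable O.oracle s)) w := by
  refine oddsProd_le_oddsProd O.one_le w fun u hu => ?_
  rw [entryOdds_oracleTable, if_pos ((encode_le_of_prefix hu).trans_lt h)]

theorem denProd_pos (O : AcceptableOdds) (s : ℕ) (w : List Bool) :
    0 < denProd (oracleTable O.oracle s) w := by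
  rw [denProd, prod_map_range]
  refine Finset.prod_pos fun i _ => ?_
  rw [entry_oracleTable]
  split_ifs
  · simpa using (O.odds _).den_pos
  · simp

/-! ### Computability of the products read from a table -/

theorem computable_entry : Computable₂ entry :=
  Computable.option_getD (Computable.list_getElem?.comp Computable.fst
    (Computable.encode.comp Computable.snd)) (Computable.const _)

theorem computable_entry_take :
    Computable₂ fun (p : List ℕ × List Bool) (i : ℕ) => (entry p.1 (p.2.take i)).unpair :=
  Computable.unpair.comp (computable_entry.comp (Computable.fst.comp Computable.fst)
    (Primrec.list_take.to_comp.comp Computable.snd (Computable.snd.comp Computable.fst)))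

theorem computable_prefixLengths :
    Computable fun p : List ℕ × List Bool => List.range (p.2.length + 1) :=
  Primrec.list_range.to_comp.comp (Computable.succ.comp (Computable.list_length.comp Computable.snd))

theorem computable_numProd : Computable₂ numProd :=
  computable_prod_map computable_prefixLengths (Computable.fst.comp computable_entry_take)

theorem computable_denProd : Computable₂ denProd :=
  computable_prod_map computable_prefixLengths (Computable.snd.comp computable_entry_take)

theorem computable_two_pow : Computable fun n : ℕ => 2 ^ n := by
  refine (Computable.nat_rec (f := fun n : ℕ => n) (g := fun _ => 1) (h := fun _ p => p.2 * 2)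
    Computable.id (Computable.const 1) ?_).of_eq fun n => ?_
  · exact Primrec.nat_mul.to_comp.comp (Computable.snd.comp Computable.snd) (Computable.const 2)
  · induction n with
    | zero => rfl
    | succ n ih => rw [pow_succ, ← ih]

/-! ### Levels of growth -/

/-- The first summand cancels the weight of a string placed at level `i + 1`; the second is the
profit. -/
def growth (i : ℕ) : ℕ := Nat.pair (i + 1) (i + 1) + i

/-- The table `σ` shows that all products of odds of length `σ.length` are at least
`2 ^ growth i`. -/
def reaches (σ : List ℕ) (i : ℕ) : Bool :=
  (strs σ.length).all fun w => decide (2 ^ growth i * denProd σ w ≤ numProd σ w)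

/-- A level at which all products of odds are at least `2 ^ growth i`. -/
noncomputable def level (o : ℕ → ℕ) (i : ℕ) : ℕ := sInf {s | reaches (oracleTable o s) i = true}

theorem reaches_oracleTable (O : AcceptableOdds) (s i : ℕ) :
    reaches (oracleTable O.oracle s) i = true ↔ ∀ w : List Bool, w.length = s →
      2 ^ growth i ≤ oddsProd (entryOdds (oracleTable O.oracle s)) w := by
  rw [reaches, List.all_eq_true]
  refine forall_congr' fun w => ?_
  rw [mem_strs, oracleTable, List.length_map, List.length_range]
  refine imp_congr_right fun _ => ?_
  have := denProd_pos O s w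
  rw [← oracleTable, oddsProd_entryOdds, le_div_iff₀ (by exact_mod_cast this), decide_eq_true_iff]
  exact_mod_cast Iff.rfl

theorem exists_reaches (O : AcceptableOdds) (i : ℕ) :
    ∃ s, reaches (oracleTable O.oracle s) i = true := by
  obtain ⟨l, hl⟩ := exists_le_oddsProd O (2 ^ growth i)
  -- The table must contain the codes of all strings of length `l`, and its length, at which the
  -- products are tested, must be at least `l`.
  refine ⟨l + ((strs l).toFinset.sup encode + 1), (reaches_oracleTable O _ i).2 fun w hw => ?_⟩
  have hlen : (w.take l).length = l := by rw [List.length_take, hw]; omega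
  refine (hl _ hlen).trans ((oddsProd_le_entryOdds O ?_).trans
    (oddsProd_le_of_prefix (one_le_entryOdds O _) (List.take_prefix l w)))
  have : encode (w.take l) ≤ (strs l).toFinset.sup encode :=
    Finset.le_sup (f := encode) (List.mem_toFinset.2 (mem_strs.2 hlen))
  omega

theorem le_oddsProd_of_level_le (O : AcceptableOdds) (i : ℕ) {w : List Bool}
    (hw : level O.oracle i ≤ w.length) : 2 ^ growth i ≤ oddsProd O.odds w := by
  have h := (reaches_oracleTable O _ i).1 (Nat.sInf_mem (exists_reaches O i))
    (w.take (level O.oracle i)) (by rw [List.length_take]; exact min_eq_left hw)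
  exact h.trans ((oddsProd_entryOdds_le O _ _).trans
    (oddsProd_le_of_prefix O.one_le (List.take_prefix _ _)))

/-- A product over a string of length `s` is at most `2 ^ (s + 1)`, while `growth i ≥ 2 * i + 1`. -/
theorem le_level (O : AcceptableOdds) (i : ℕ) : i ≤ level O.oracle i := by
  have h := le_oddsProd_of_level_le O i (w := List.replicate (level O.oracle i) false) (by simp)
  have h' := h.trans (oddsProd_le_two_pow O.one_le O.le_two _)
  rw [List.length_replicate] at h'
  have h'' := (pow_le_pow_iff_right₀ (one_lt_two (α := ℚ))).1 h'
  have : i + 1 ≤ Nat.pair (i + 1) (i + 1) := Nat.left_le_pair _ _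
  rw [growth] at h''
  omega

theorem computable_reaches : Computable₂ reaches := by
  refine computable_all (f := fun p : List ℕ × ℕ => strs p.1.length)
    (p := fun p w => decide (2 ^ growth p.2 * denProd p.1 w ≤ numProd p.1 w))
    (primrec_strs.to_comp.comp (Computable.list_length.comp Computable.fst)) ?_
  have hg : Computable growth := by
    refine Primrec.nat_add.to_comp.comp (Primrec₂.natPair.to_comp.comp ?_ ?_) Computable.id
    · exact Computable.succ
    · exact Computable.succ
  have hle : Computable₂ fun a b : ℕ => decide (a ≤ b) := Primrec.nat_le.decide.to_comp
  refine hle.comp (Primrec.nat_mul.to_comp.comp (computable_two_pow.comp (hg.comp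
    (Computable.snd.comp Computable.fst))) (computable_denProd.comp ?_ ?_))
    (computable_numProd.comp ?_ ?_)
  · exact Computable.fst.comp Computable.fst
  · exact Computable.snd
  · exact Computable.fst.comp Computable.fst
  · exact Computable.snd

theorem oracleComputable_oracleTable (A : Set (ℕ → ℕ)) : OracleComputable A oracleTable :=
  OracleComputable.query.table

theorem oracleComputable_level :
    OracleComputable (Set.range AcceptableOdds.oracle) level := by
  refine OracleComputable.find (p := fun o (q : ℕ × ℕ) => reaches (oracleTable o q.2) q.1) ?_ ?_
  · exact OracleComputable.comp
      (OracleComputable.of_computable (g := fun q : List ℕ × ℕ => reaches q.1 q.2)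
        computable_reaches)
      (((oracleComputable_oracleTable _).comp
        (OracleComputable.of_computable Computable.snd)).pair
        (OracleComputable.of_computable Computable.fst))
  · rintro _ ⟨O, rfl⟩ i
    exact exists_reaches O i

/-! ### The supermartingale of a computable family -/

/-- The `t`-th string on which capital is placed, where `m i` is the `i`-th level. -/
def target (L : ℕ × ℕ → List (List Bool)) (m : ℕ → ℕ) (t : ℕ) : Option (List Bool) :=
  (distinct (L (t.unpair.2.unpair.1, m t.unpair.1)))[t.unpair.2.unpair.2]?

def hit (v : Option (List Bool)) (w : List Bool) : ℕ :=
  (v.map fun v => if w <+: v then 1 else 0).getD 0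

theorem hit_le_one (v : Option (List Bool)) (w : List Bool) : hit v w ≤ 1 := by
  rcases v with _ | v
  · simp [hit]
  · simp only [hit, Option.map_some, Option.getD_some]
    split_ifs <;> simp

theorem hit_add_hit_le (v : Option (List Bool)) (w : List Bool) :
    hit v (w ++ [false]) + hit v (w ++ [true]) ≤ hit v w := by
  rcases v with _ | v
  · simp [hit]
  · simp only [hit, Option.map_some, Option.getD_some]
    have h1 : ∀ b, w ++ [b] <+: v → w <+: v := fun b h => (List.prefix_append w [b]).trans h
    by_cases h : w <+: v
    · have h2 : ¬ (w ++ [false] <+: v ∧ w ++ [true] <+: v) := by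
        rintro ⟨hf, ht⟩
        have := List.prefix_of_prefix_length_le hf ht (by simp)
        simp at this
      by_cases hf : w ++ [false] <+: v <;> by_cases ht : w ++ [true] <+: v <;> simp_all
    · have hf : ¬ w ++ [false] <+: v := fun h' => h (h1 _ h')
      have ht : ¬ w ++ [true] <+: v := fun h' => h (h1 _ h')
      simp [h, hf, ht]

theorem computable_hit : Computable₂ hit := by
  have hp : Primrec₂ fun w v : List Bool => if w <+: v then 1 else 0 := by
    refine Primrec.ite (c := fun p : List Bool × List Bool => p.1 <+: p.2) ?_
      (Primrec.const 1) (Primrec.const 0)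
    refine (PrimrecPred.of_eq (p := fun p : List Bool × List Bool =>
      p.1 = p.2.take p.1.length) ?_ fun p => List.prefix_iff_eq_take.symm)
    exact Primrec.eq.comp Primrec.fst
      (Primrec.list_take.comp (Primrec.list_length.comp Primrec.fst) Primrec.snd)
  exact Computable.option_getD (Computable.option_map Computable.fst
    (hp.to_comp.comp (Computable.snd.comp Computable.fst) Computable.snd)) (Computable.const 0)

theorem summable_half_pow_mul {a : ℕ → ℝ} (h0 : ∀ t, 0 ≤ a t) (h1 : ∀ t, a t ≤ 1) :
    Summable fun t => (1 / 2 : ℝ) ^ t * a t :=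
  Summable.of_nonneg_of_le (fun t => mul_nonneg (by positivity) (h0 t))
    (fun t => mul_le_of_le_one_right (by positivity) (h1 t)) summable_geometric_two

theorem abs_sum_sub_tsum_le {a : ℕ → ℝ} (h0 : ∀ t, 0 ≤ a t) (h1 : ∀ t, a t ≤ 1) (N : ℕ) :
    |∑ t ∈ Finset.range N, (1 / 2 : ℝ) ^ t * a t - ∑' t, (1 / 2 : ℝ) ^ t * a t| ≤
      2 * (1 / 2) ^ N := by
  have hs := summable_half_pow_mul h0 h1
  rw [← hs.sum_add_tsum_nat_add N, sub_add_cancel_left, abs_neg]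
  have hs' := (summable_nat_add_iff N).2 hs
  have hg := (summable_nat_add_iff N).2 summable_geometric_two
  rw [abs_of_nonneg (tsum_nonneg fun t => mul_nonneg (by positivity) (h0 _))]
  refine (hs'.tsum_le_tsum (fun t => mul_le_of_le_one_right (by positivity) (h1 _)) hg).trans ?_
  simp only [pow_add]
  rw [tsum_mul_right, tsum_geometric_two]

/-- The proportion of the initial capital that is placed on extensions of `w`. -/
noncomputable def stake (L : ℕ × ℕ → List (List Bool)) (m : ℕ → ℕ) (w : List Bool) : ℝ :=
  ∑' t, (1 / 2 : ℝ) ^ t * (hit (target L m t) w : ℝ)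

theorem summable_stake (L : ℕ × ℕ → List (List Bool)) (m : ℕ → ℕ) (w : List Bool) :
    Summable fun t => (1 / 2 : ℝ) ^ t * (hit (target L m t) w : ℝ) :=
  summable_half_pow_mul (fun _ => Nat.cast_nonneg _) fun _ => by exact_mod_cast hit_le_one _ _

theorem isSupermartingale_stake (O : AcceptableOdds) (L : ℕ × ℕ → List (List Bool)) (m : ℕ → ℕ) :
    IsSupermartingale O.odds fun w => (oddsProd O.odds w : ℝ) * stake L m w := by
  refine isSupermartingale_oddsProd_mul O.one_le
    (fun w => tsum_nonneg fun t => by positivity) fun w => ?_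
  rw [stake, stake, ← (summable_stake L m _).tsum_add (summable_stake L m _)]
  refine ((summable_stake L m _).add (summable_stake L m _)).tsum_le_tsum (fun t => ?_)
    (summable_stake L m _)
  rw [← mul_add]
  refine mul_le_mul_of_nonneg_left ?_ (by positivity)
  exact_mod_cast hit_add_hit_le _ _

theorem le_length_of_isWeakConstructor {δ : ℕ → Finset (List Bool)} (h : IsWeakConstructor δ)
    {n : ℕ} {w : List Bool} (hw : w ∈ δ n) : n ≤ w.length := by
  obtain ⟨b, -, h⟩ := h
  induction n generalizing w with
  | zero => exact Nat.zero_le _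
  | succ n ih =>
    obtain ⟨u, hu, huw, hne⟩ := h n w hw
    have h1 := ih hu
    have h2 := huw.length_le
    have h3 : u.length ≠ w.length := fun h => hne (huw.eq_of_length h)
    omega

theorem succeedsStrongly_stake (O : AcceptableOdds) {L : ℕ × ℕ → List (List Bool)}
    {δ : ℕ → ℕ → Finset (List Bool)} (hL : ∀ k n, (L (k, n)).toFinset = δ k n) {k : ℕ}
    (hδ : IsWeakConstructor (δ k)) {S : ℕ → Bool} (hS : S ∈ weakResult (δ k)) :
    SucceedsStrongly (fun w => (oddsProd O.odds w : ℝ) * stake L (level O.oracle) w) S := by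
  obtain ⟨b, hb, -⟩ := id hδ
  have hstake : ∀ i n, Nat.pair k b ≤ i → n ≤ level O.oracle i →
      (1 / 2 : ℝ) ^ Nat.pair i i ≤ stake L (level O.oracle) (initSeg S n) := by
    intro i n hi hn
    obtain ⟨v, hv, hvS⟩ := hS (level O.oracle i)
    have hlen := le_length_of_isWeakConstructor hδ hv
    obtain ⟨hnd, hfin⟩ := distinct_spec (L (k, level O.oracle i))
    -- Without repetitions the position of `v` is below `b`, whatever the level; the given list
    -- itself could be arbitrarily long.
    have hmem : v ∈ distinct (L (k, level O.oracle i)) := by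
      rw [← List.mem_toFinset, hfin, hL]
      exact hv
    obtain ⟨p, hp, hpv⟩ := List.getElem_of_mem hmem
    have hpb : p < b := by
      refine hp.trans_le ?_
      rw [← List.toFinset_card_of_nodup hnd, hfin, hL]
      exact hb _
    have htarget : target L (level O.oracle) (Nat.pair i (Nat.pair k p)) = some v := by
      simp [target, hp, hpv]
    have hhit : hit (target L (level O.oracle) (Nat.pair i (Nat.pair k p))) (initSeg S n) = 1 := by
      rw [htarget]
      have : initSeg S n <+: v := by
        rw [← show initSeg S v.length = v from hvS]
        exact initSeg_prefix S (hn.trans hlen)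
      simp [hit, this]
    have hle := (summable_stake L (level O.oracle) (initSeg S n)).le_tsum
      (Nat.pair i (Nat.pair k p)) fun _ _ => by positivity
    rw [hhit, Nat.cast_one, mul_one] at hle
    refine le_trans (pow_le_pow_of_le_one (by norm_num) (by norm_num) ?_) hle
    exact (Nat.pair_lt_pair_right i ((Nat.pair_lt_pair_right k hpb).trans_le hi)).le
  rw [succeedsStrongly_iff]
  intro C
  obtain ⟨c, hc⟩ := pow_unbounded_of_one_lt C (one_lt_two (α := ℝ))
  set M := max c (Nat.pair k b) with hM
  filter_upwards [Filter.eventually_ge_atTop (level O.oracle M)] with n hn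
  -- The least such `j` satisfies `level j ≤ n < level (j + 1)`: the product is controlled from
  -- level `j`, the stake from level `j + 1`.
  have hex : ∃ j, M ≤ j ∧ n < level O.oracle (j + 1) :=
    ⟨max M n, le_max_left _ _, lt_of_lt_of_le (Nat.lt_succ_of_le (le_max_right M n)) (le_level O _)⟩
  classical
  obtain ⟨hj1, hj2⟩ := Nat.find_spec hex
  set j := Nat.find hex with hj
  have hj3 : level O.oracle j ≤ n := by
    rcases hj1.eq_or_lt with h | h
    · rwa [← h]
    · by_contra! hlt
      have := Nat.find_min hex (m := j - 1) (by omega)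
      refine this ⟨by omega, ?_⟩
      rwa [Nat.sub_add_cancel (by omega)]
  have hs := hstake (j + 1) n ((le_max_right c _).trans (hj1.trans (Nat.le_succ j))) hj2.le
  have hp : (2 : ℝ) ^ growth j ≤ oddsProd O.odds (initSeg S n) := by
    have := le_oddsProd_of_level_le O j (w := initSeg S n) (by simpa using hj3)
    exact_mod_cast this
  calc C ≤ 2 ^ c := hc.le
    _ ≤ 2 ^ j := pow_le_pow_right₀ one_le_two ((le_max_left c _).trans hj1)
    _ = 2 ^ growth j * (1 / 2) ^ Nat.pair (j + 1) (j + 1) := by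
      rw [growth, pow_add, one_div, inv_pow]
      field_simp
    _ ≤ _ := mul_le_mul hp hs (by positivity) (le_trans (by positivity) hp)

/-- The code of an approximation to `oddsProd O.odds w * stake L m w` with error at most
`(1 / 2) ^ r`, from a table `Λ` of levels and a table `σ` of oracle answers. -/
def stakeApprox (L : ℕ × ℕ → List (List Bool)) (q : (ℕ × List Bool) × List ℕ × List ℕ) : ℕ :=
  let N := q.1.1 + q.1.2.length + 2
  Nat.pair (numProd q.2.2 q.1.2 * ((List.range N).map fun t =>
      2 ^ (N - t) * hit (target L (fun i => (q.2.1[i]?).getD 0) t) q.1.2).sum)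
    (denProd q.2.2 q.1.2 * 2 ^ N - 1)

theorem computable_stakeApprox {L : ℕ × ℕ → List (List Bool)} (hL : Computable L) :
    Computable (stakeApprox L) := by
  have hN : Computable fun q : (ℕ × List Bool) × List ℕ × List ℕ =>
      q.1.1 + q.1.2.length + 2 :=
    Primrec.nat_add.to_comp.comp (Primrec.nat_add.to_comp.comp
      (Computable.fst.comp Computable.fst)
      (Computable.list_length.comp (Computable.snd.comp Computable.fst))) (Computable.const 2)
  have hw : Computable fun q : (ℕ × List Bool) × List ℕ × List ℕ => q.1.2 :=
    Computable.snd.comp Computable.fst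
  have hσ : Computable fun q : (ℕ × List Bool) × List ℕ × List ℕ => q.2.2 :=
    Computable.snd.comp Computable.snd
  have htarget : Computable₂ fun (Λ : List ℕ) (t : ℕ) =>
      target L (fun i => (Λ[i]?).getD 0) t := by
    have h1 : Computable fun p : List ℕ × ℕ => p.2.unpair.1 :=
      Computable.fst.comp (Computable.unpair.comp Computable.snd)
    have h2 : Computable fun p : List ℕ × ℕ => p.2.unpair.2.unpair :=
      Computable.unpair.comp (Computable.snd.comp (Computable.unpair.comp Computable.snd))
    refine Computable.list_getElem?.comp (computable_distinct.comp (hL.comp (Computable.pair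
      (Computable.fst.comp h2) ?_))) (Computable.snd.comp h2)
    exact Computable.option_getD (Computable.list_getElem?.comp Computable.fst h1)
      (Computable.const 0)
  refine Primrec₂.natPair.to_comp.comp (Primrec.nat_mul.to_comp.comp
    (computable_numProd.comp hσ hw) (computable_sum_map (Primrec.list_range.to_comp.comp hN) ?_))
    (Primrec.nat_sub.to_comp.comp (Primrec.nat_mul.to_comp.comp (computable_denProd.comp hσ hw)
      (computable_two_pow.comp hN)) (Computable.const 1))
  exact Primrec.nat_mul.to_comp.comp (computable_two_pow.comp (Primrec.nat_sub.to_comp.comp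
    (hN.comp Computable.fst) Computable.snd)) (computable_hit.comp
      (htarget.comp (Computable.fst.comp (Computable.snd.comp Computable.fst)) Computable.snd)
      (hw.comp Computable.fst))

/-- The product of odds is exact and at most `2 ^ (w.length + 1)`; truncating the series after `N`
terms costs at most `2 * 2 ^ (-N)`. The choice of `N` makes the product of these two bounds equal to
`2 ^ (-r)`. -/
theorem abs_stakeApprox_sub_le (L : ℕ × ℕ → List (List Bool)) (O : AcceptableOdds) (r : ℕ)
    (w : List Bool) :
    |(ratOfCode (stakeApprox L ((r, w),
        (List.range (r + w.length + 2)).map (level O.oracle),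
        oracleTable O.oracle (encode w + 1))) : ℝ) -
      oddsProd O.odds w * stake L (level O.oracle) w| ≤ (1 / 2 : ℝ) ^ r := by
  set N := r + w.length + 2 with hN
  set σ := oracleTable O.oracle (encode w + 1) with hσ
  set a : ℕ → ℕ := fun t => hit (target L (level O.oracle) t) w with ha
  have hsum : ((List.range N).map fun t => 2 ^ (N - t) * hit (target L
      (fun i => ((List.range N).map (level O.oracle))[i]?.getD 0) t) w).sum =
      ∑ t ∈ Finset.range N, 2 ^ (N - t) * a t := by
    rw [← List.sum_toFinset _ List.nodup_range, List.toFinset_range]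
    refine Finset.sum_congr rfl fun t ht => ?_
    have : t.unpair.1 < N := (Nat.unpair_left_le t).trans_lt (Finset.mem_range.1 ht)
    simp [ha, target, this]
  have hP : (oddsProd O.odds w : ℚ) = numProd σ w / denProd σ w := by
    rw [← oddsProd_entryOdds]
    exact le_antisymm (oddsProd_le_entryOdds O (Nat.lt_succ_self _)) (oddsProd_entryOdds_le O _ w)
  have hden := denProd_pos O (encode w + 1) w
  rw [← hσ] at hden
  have hrat : ratOfCode (stakeApprox L ((r, w), (List.range N).map (level O.oracle), σ)) =
      oddsProd O.odds w * ∑ t ∈ Finset.range N, (1 / 2) ^ t * (a t : ℚ) := by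
    simp only [stakeApprox, ← hN, ratOfCode, Nat.unpair_pair, hsum]
    -- `ratOfCode` adds 1 to the second component, so `stakeApprox` subtracts it; positivity makes
    -- this truncated subtraction exact.
    have h1 : 1 ≤ denProd σ w * 2 ^ N := Nat.mul_pos hden (by positivity)
    rw [Nat.cast_sub h1, hP]
    push_cast
    rw [sub_add_cancel, mul_div_mul_comm]
    congr 1
    rw [Finset.sum_div]
    refine Finset.sum_congr rfl fun t ht => ?_
    rw [pow_sub₀ _ two_ne_zero (Finset.mem_range.1 ht).le, one_div, inv_pow]
    field_simp
  rw [hrat]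
  push_cast
  rw [← mul_sub, abs_mul]
  have h1 : |(oddsProd O.odds w : ℝ)| ≤ 2 ^ (w.length + 1) := by
    rw [abs_of_nonneg (by exact_mod_cast (oddsProd_pos O.one_le w).le)]
    exact_mod_cast oddsProd_le_two_pow O.one_le O.le_two w
  have h2 := abs_sum_sub_tsum_le (a := fun t => (a t : ℝ)) (fun _ => Nat.cast_nonneg _)
    (fun t => by exact_mod_cast hit_le_one _ _) N
  refine (mul_le_mul h1 h2 (abs_nonneg _) (by positivity)).trans (le_of_eq ?_)
  rw [hN, pow_add, pow_add, pow_add, one_div, inv_pow, inv_pow]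
  field_simp

theorem HasComputableSPDZ.of_weaklyComputablyCountable {X : Set (ℕ → Bool)}
    (h : WeaklyComputablyCountable X) : HasComputableSPDZ X := by
  obtain ⟨δ, ⟨L, hLc, hL⟩, hδ, hX⟩ := h
  refine ⟨fun O w => oddsProd O.odds w * stake L (level O.oracle) w, ?_, fun O =>
    ⟨isSupermartingale_stake O L _, fun S hS => ?_⟩⟩
  · obtain ⟨M, hM⟩ : OracleComputable (Set.range AcceptableOdds.oracle)
        fun o (x : ℕ × List Bool) => stakeApprox L (x,
          (List.range (x.1 + x.2.length + 2)).map (level o), oracleTable o (encode x.2 + 1)) := by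
      refine (OracleComputable.of_computable (computable_stakeApprox hLc)).comp
        ((OracleComputable.of_computable Computable.id).pair
          ((oracleComputable_level.table.comp (OracleComputable.of_computable ?_)).pair
            ((oracleComputable_oracleTable _).comp (OracleComputable.of_computable ?_))))
      · exact Primrec.nat_add.to_comp.comp (Primrec.nat_add.to_comp.comp Computable.fst
          (Computable.list_length.comp Computable.snd)) (Computable.const 2)
      · exact Computable.succ.comp (Computable.encode.comp Computable.snd)
    refine ⟨M, fun O r w => ⟨_, ?_, abs_stakeApprox_sub_le L O r w⟩⟩
    have := hM O.oracle ⟨O, rfl⟩ (r, w)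
    rw [OracleProgram.run, encode_prod_val, encode_nat] at this
    rw [this]
    exact Part.mem_some _
  · obtain ⟨k, hk⟩ := Set.mem_iUnion.1 (hX hS)
    exact succeedsStrongly_stake O hL (hδ k) hk

/-! ### Odds functions with values one and two -/

/-! ### The converse direction: finite conditions and trees of accepted strings -/

def bitOdds (B : List Bool → Bool) (w : List Bool) : ℚ := if B w then 2 else 1

theorem one_le_bitOdds (B : List Bool → Bool) (w : List Bool) : 1 ≤ bitOdds B w := by
  rw [bitOdds]
  split_ifs <;> norm_num

theorem bitOdds_le_two (B : List Bool → Bool) (w : List Bool) : bitOdds B w ≤ 2 := by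
  rw [bitOdds]
  split_ifs <;> norm_num

/-- There are arbitrarily high levels at which all bits are `true`. -/
def FrequentlyFull (B : List Bool → Bool) : Prop :=
  ∀ m, ∃ l, m ≤ l ∧ ∀ w : List Bool, w.length = l → B w = true

/-- Every full level doubles the product along every sequence, and no other factor decreases it. -/
def ofBits (B : List Bool → Bool) (hB : FrequentlyFull B) : AcceptableOdds where
  odds := bitOdds B
  one_le := one_le_bitOdds B
  le_two := bitOdds_le_two B
  acceptable S := by
    have hmono : Monotone fun n => ∏ i ∈ Finset.range n, bitOdds B (initSeg S i) := by
      refine monotone_nat_of_le_succ fun n => ?_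
      rw [Finset.prod_range_succ]
      exact le_mul_of_one_le_right
        (Finset.prod_nonneg fun i _ => zero_le_one.trans (one_le_bitOdds B _)) (one_le_bitOdds B _)
    have hpow : ∀ k : ℕ, ∃ n, (2 : ℚ) ^ k ≤ ∏ i ∈ Finset.range n, bitOdds B (initSeg S i) := by
      intro k
      induction k with
      | zero => exact ⟨0, by simp⟩
      | succ k ih =>
        obtain ⟨n, hn⟩ := ih
        obtain ⟨l, hl, hBl⟩ := hB n
        refine ⟨l + 1, ?_⟩
        rw [Finset.prod_range_succ, pow_succ, bitOdds, if_pos (hBl _ (length_initSeg S l))]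
        exact mul_le_mul_of_nonneg_right (hn.trans (hmono hl)) zero_le_two
    refine Filter.tendsto_atTop_atTop_of_monotone hmono fun C => ?_
    obtain ⟨k, hk⟩ := pow_unbounded_of_one_lt C (one_lt_two (α := ℚ))
    obtain ⟨n, hn⟩ := hpow k
    exact ⟨n, hk.le.trans hn⟩

def bitOracle (B : List Bool → Bool) (c : ℕ) : ℕ :=
  ((decode c : Option (List Bool)).map fun w => bif B w then Nat.pair 2 1 else Nat.pair 1 1).getD 0

theorem oracle_ofBits (B : List Bool → Bool) (hB : FrequentlyFull B) :
    (ofBits B hB).oracle = bitOracle B := by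
  funext c
  rw [AcceptableOdds.oracle, bitOracle]
  rcases (decode c : Option (List Bool)) with _ | w
  · rfl
  · simp only [ofBits, bitOdds, Option.map_some, Option.getD_some]
    cases B w <;> simp

theorem mem_run_bitOracle_of_agree (M : OracleProgram) {B : List Bool → Bool} {x y : ℕ}
    (h : y ∈ M.run (bitOracle B) x) : ∃ s, ∀ B' : List Bool → Bool,
      (∀ w, encode w < s → B' w = B w) → y ∈ M.run (bitOracle B') x := by
  obtain ⟨s, hs⟩ := M.mem_run_of_agree h
  refine ⟨(Finset.range s).sup fun c =>
    ((decode c : Option (List Bool)).map fun w => encode w + 1).getD 0, fun B' hB' =>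
      hs _ fun c hc => ?_⟩
  have hle := Finset.le_sup (f := fun c =>
    ((decode c : Option (List Bool)).map fun w => encode w + 1).getD 0) (Finset.mem_range.2 hc)
  rw [bitOracle, bitOracle]
  rcases hd : (decode c : Option (List Bool)) with _ | w
  · rfl
  · simp only [hd, Option.map_some, Option.getD_some] at hle ⊢
    rw [hB' w hle]

/-! ### Finite conditions on the odds -/

/-- The condition `p` determines the bits of the strings whose codes are less than `p.length`;
`p ≤ q` in this order when `q` determines the same bits and possibly more. -/
def CondLe (p q : List Bool) : Prop :=
  p.length ≤ q.length ∧ ∀ w : List Bool, encode w < p.length → q[encode w]? = p[encode w]?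

theorem CondLe.refl (p : List Bool) : CondLe p p := ⟨le_rfl, fun _ _ => rfl⟩

theorem CondLe.trans {p q r : List Bool} (h : CondLe p q) (h' : CondLe q r) : CondLe p r :=
  ⟨h.1.trans h'.1, fun w hw => (h'.2 w (hw.trans_le h.1)).trans (h.2 w hw)⟩

def Extends (p : List Bool) (B : List Bool → Bool) : Prop :=
  ∀ w, encode w < p.length → p[encode w]? = some (B w)

theorem Extends.of_condLe {p q : List Bool} {B : List Bool → Bool} (h : Extends q B)
    (hpq : CondLe p q) : Extends p B :=
  fun w hw => (hpq.2 w hw).symm.trans (h w (hw.trans_le hpq.1))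

/-- The condition that consists of the bits of `B` at the strings with codes less than `s`. -/
def restrictBits (B : List Bool → Bool) (s : ℕ) : List Bool :=
  (List.range s).map fun c => ((decode c : Option (List Bool)).map B).getD false

@[simp] theorem length_restrictBits (B : List Bool → Bool) (s : ℕ) :
    (restrictBits B s).length = s := by simp [restrictBits]

theorem extends_restrictBits (B : List Bool → Bool) (s : ℕ) : Extends (restrictBits B s) B := by
  intro w hw
  rw [length_restrictBits] at hw
  simp [restrictBits, hw]

theorem Extends.eq_of_restrictBits {B B' : List Bool → Bool} {s : ℕ}
    (h : Extends (restrictBits B s) B') {w : List Bool} (hw : encode w < s) : B' w = B w := by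
  have h1 := h w (by simpa using hw)
  rw [extends_restrictBits B s w (by simpa using hw)] at h1
  exact (Option.some_inj.1 h1).symm

theorem condLe_restrictBits {p : List Bool} {B : List Bool → Bool} (h : Extends p B) {s : ℕ}
    (hs : p.length ≤ s) : CondLe p (restrictBits B s) :=
  ⟨by simpa using hs, fun w hw => (extends_restrictBits B s w (by simpa using hw.trans_le hs)).trans
    (h w hw).symm⟩

/-- The bits given by the condition `p`, and elsewhere `false` up to length `n` and `true`
beyond. -/
def condBit (p : List Bool) (n : ℕ) (w : List Bool) : Bool :=
  (p[encode w]?).getD (decide (n < w.length))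

/-- A code is at least the length of its string, so `p` says nothing about strings of length at
least `p.length`. -/
theorem condBit_of_le_length {p : List Bool} (n : ℕ) {w : List Bool} (h : p.length ≤ w.length) :
    condBit p n w = decide (n < w.length) := by
  have := h.trans (length_le_encode w)
  simp [condBit, this]

theorem extends_condBit (p : List Bool) (n : ℕ) : Extends p (condBit p n) := by
  intro w hw
  simp [condBit, hw]

theorem frequentlyFull_condBit (p : List Bool) (n : ℕ) : FrequentlyFull (condBit p n) := by
  refine fun m => ⟨m + p.length + n + 1, by omega, fun w hw => ?_⟩
  rw [condBit_of_le_length n (by omega), decide_eq_true_iff]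
  omega

/-- Only the prefixes shorter than `p.length` can have odds 2. -/
theorem oddsProd_condBit_le {p : List Bool} {n : ℕ} (hn : p.length ≤ n) {w : List Bool}
    (hw : w.length = n) : oddsProd (bitOdds (condBit p n)) w ≤ 2 ^ p.length := by
  have h : oddsProd (bitOdds (condBit p n)) w =
      ∏ i ∈ Finset.range p.length, bitOdds (condBit p n) (w.take i) := by
    refine (Finset.prod_subset (Finset.range_mono (by omega)) fun i hi hi' => ?_).symm
    rw [Finset.mem_range] at hi hi'
    have hlen : (w.take i).length = i := by rw [List.length_take]; omega
    rw [bitOdds, condBit_of_le_length n (by omega), hlen, if_neg]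
    simp only [decide_eq_true_iff]
    omega
  rw [h]
  have := Finset.prod_le_prod (s := Finset.range p.length)
    (f := fun i => bitOdds (condBit p n) (w.take i)) (g := fun _ => (2 : ℚ))
    (fun i _ => zero_le_one.trans (one_le_bitOdds _ _)) fun i _ => bitOdds_le_two _ _
  rwa [Finset.prod_const, Finset.card_range] at this

theorem computable_bitOracle_condBit :
    Computable₂ fun (q : List Bool × ℕ) (c : ℕ) => bitOracle (condBit q.1 q.2) c := by
  have hbit : Computable₂ fun (q : List Bool × ℕ) (w : List Bool) => condBit q.1 q.2 w := by
    have hlt : Computable₂ fun a b : ℕ => decide (a < b) := Primrec.nat_lt.decide.to_comp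
    exact Computable.option_getD (Computable.list_getElem?.comp
      (Computable.fst.comp Computable.fst) (Computable.encode.comp Computable.snd))
      (hlt.comp (Computable.snd.comp Computable.fst) (Computable.list_length.comp Computable.snd))
  refine Computable.option_getD (Computable.option_map (Computable.decode.comp Computable.snd) ?_)
    (Computable.const 0)
  exact Computable.cond (hbit.comp (Computable.fst.comp Computable.fst) Computable.snd)
    (Computable.const _) (Computable.const _)

/-! ### Trees of bounded width -/

/-- The list `l` if it has at most `b` elements, and otherwise the empty list. -/
def clip (b : ℕ) (l : List (List Bool)) : List (List Bool) :=
  bif decide (l.length ≤ b) then l else []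

theorem clip_of_le {b : ℕ} {l : List (List Bool)} (h : l.length ≤ b) : clip b l = l := by
  simp [clip, h]

theorem length_clip_le (b : ℕ) (l : List (List Bool)) : (clip b l).length ≤ b := by
  by_cases h : l.length ≤ b <;> simp [clip, h]

theorem clip_sublist (b : ℕ) (l : List (List Bool)) : (clip b l).Sublist l := by
  by_cases h : l.length ≤ b <;> simp [clip, h]

/-- The tree of the strings whose prefixes of length `n` are accepted by `acc n`, for `n` at
least `m`, cut off where the width exceeds `b`. -/
def clippedTree (acc : ℕ → List Bool → Bool) (m b j : ℕ) : List (List Bool) :=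
  Nat.rec (clip b ((strs m).filter (acc m)))
    (fun j l => clip b ((l.flatMap fun w => [w ++ [false], w ++ [true]]).filter
      (acc (m + j + 1)))) j

theorem clippedTree_succ (acc : ℕ → List Bool → Bool) (m b j : ℕ) :
    clippedTree acc m b (j + 1) = clip b (((clippedTree acc m b j).flatMap
      fun w => [w ++ [false], w ++ [true]]).filter (acc (m + j + 1))) := rfl

theorem length_clippedTree_le (acc : ℕ → List Bool → Bool) (m b j : ℕ) :
    (clippedTree acc m b j).length ≤ b := by
  cases j <;> exact length_clip_le _ _

theorem sublist_flatMap {α β : Type*} {l l' : List α} (h : l.Sublist l') (f : α → List β) :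
    (l.flatMap f).Sublist (l'.flatMap f) := by
  induction h with
  | slnil => simp
  | cons a _ ih => exact ih.trans (by simp)
  | cons_cons a _ ih => simpa using ih

theorem clippedTree_sublist (acc : ℕ → List Bool → Bool) (m b j : ℕ) :
    (clippedTree acc m b j).Sublist (strs (m + j)) := by
  induction j with
  | zero => exact (clip_sublist _ _).trans List.filter_sublist
  | succ j ih =>
    exact (clip_sublist _ _).trans (List.filter_sublist.trans (sublist_flatMap ih _))

theorem isWeakConstructor_clippedTree (acc : ℕ → List Bool → Bool) (m b : ℕ) :
    IsWeakConstructor fun j => (clippedTree acc m b j).toFinset := by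
  refine ⟨b, fun j => (List.toFinset_card_le _).trans (length_clippedTree_le acc m b j),
    fun j w hw => ?_⟩
  rw [List.mem_toFinset, clippedTree_succ] at hw
  obtain ⟨u, hu, hw⟩ := List.mem_flatMap.1 (List.mem_of_mem_filter ((clip_sublist _ _).subset hw))
  refine ⟨u, List.mem_toFinset.2 hu, ?_⟩
  simp only [List.mem_cons, List.not_mem_nil, or_false] at hw
  rcases hw with rfl | rfl <;> exact ⟨List.prefix_append _ _, by simp⟩

/-- Before clipping, each level is a sublist of the accepted strings of its length, so the bound `b`
is never exceeded and nothing is lost. -/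
theorem mem_weakResult_clippedTree {acc : ℕ → List Bool → Bool} {m b : ℕ} {S : ℕ → Bool}
    (hS : ∀ n, m ≤ n → acc n (initSeg S n) = true)
    (hb : ∀ n, m ≤ n → ((strs n).filter (acc n)).length ≤ b) :
    S ∈ weakResult fun j => (clippedTree acc m b j).toFinset := by
  have h : ∀ j, initSeg S (m + j) ∈ clippedTree acc m b j := by
    intro j
    induction j with
    | zero =>
      have h0 : clippedTree acc m b 0 = clip b ((strs m).filter (acc m)) := rfl
      rw [h0, clip_of_le (hb m le_rfl), List.mem_filter]
      exact ⟨mem_strs.2 (by simp), hS m le_rfl⟩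
    | succ j ih =>
      rw [clippedTree_succ, clip_of_le, List.mem_filter]
      · exact ⟨List.mem_flatMap.2 ⟨_, ih, initSeg_succ_mem S (m + j)⟩, hS _ (by omega)⟩
      · refine le_trans (List.Sublist.length_le ?_) (hb (m + j + 1) (by omega))
        exact (sublist_flatMap (clippedTree_sublist acc m b j) _).filter _
  intro j
  refine ⟨_, List.mem_toFinset.2 (h j), ?_⟩
  rw [IsInitSeg, length_initSeg]

theorem computable_clippedTree {acc : List Bool × ℕ × List Bool → Bool} (hacc : Computable acc) :
    Computable fun q : (List Bool × ℕ) × ℕ =>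
      clippedTree (fun n w => acc (q.1.1, n, w)) q.1.1.length q.1.2 q.2 := by
  have hclip : Computable₂ clip := by
    have hle : Computable₂ fun a b : ℕ => decide (a ≤ b) := Primrec.nat_le.decide.to_comp
    exact Computable.cond (hle.comp (Computable.list_length.comp Computable.snd) Computable.fst)
      Computable.snd (Computable.const [])
  have hp : Computable fun q : (List Bool × ℕ) × ℕ => q.1.1 := Computable.fst.comp Computable.fst
  have hlen : Computable fun q : (List Bool × ℕ) × ℕ => q.1.1.length :=
    Computable.list_length.comp hp
  have hb : Computable fun q : (List Bool × ℕ) × ℕ => q.1.2 := Computable.snd.comp Computable.fst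
  have hacc₀ : Computable₂ fun (q : (List Bool × ℕ) × ℕ) w => acc (q.1.1, q.1.1.length, w) :=
    hacc.comp (g := fun x : ((List Bool × ℕ) × ℕ) × List Bool =>
        (x.1.1.1, x.1.1.1.length, x.2))
      (Computable.pair (hp.comp Computable.fst)
        (Computable.pair (hlen.comp Computable.fst) Computable.snd))
  have hbase : Computable fun q : (List Bool × ℕ) × ℕ =>
      clip q.1.2 ((strs q.1.1.length).filter fun w => acc (q.1.1, q.1.1.length, w)) :=
    hclip.comp hb (computable_filter (primrec_strs.to_comp.comp hlen) hacc₀)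
  have hlevel : Computable fun x : ((List Bool × ℕ) × ℕ) × ℕ × List (List Bool) =>
      x.1.1.1.length + x.2.1 + 1 :=
    Computable.succ.comp (Primrec.nat_add.to_comp.comp (hlen.comp Computable.fst)
      (Computable.fst.comp Computable.snd))
  have hchildren : Computable fun x : ((List Bool × ℕ) × ℕ) × ℕ × List (List Bool) =>
      x.2.2.flatMap fun w => [w ++ [false], w ++ [true]] :=
    computable_flatMap (g := fun _ w => [w ++ [false], w ++ [true]])
      (Computable.snd.comp Computable.snd) (primrec_children.to_comp.comp Computable.snd)
  have hacc₁ : Computable₂ fun (x : ((List Bool × ℕ) × ℕ) × ℕ × List (List Bool)) w =>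
      acc (x.1.1.1, x.1.1.1.length + x.2.1 + 1, w) :=
    hacc.comp (g := fun x : (((List Bool × ℕ) × ℕ) × ℕ × List (List Bool)) × List Bool =>
        (x.1.1.1.1, x.1.1.1.1.length + x.1.2.1 + 1, x.2))
      (Computable.pair (hp.comp (Computable.fst.comp Computable.fst))
        (Computable.pair (hlevel.comp Computable.fst) Computable.snd))
  have hstep : Computable₂ fun (q : (List Bool × ℕ) × ℕ) (x : ℕ × List (List Bool)) =>
      clip q.1.2 ((x.2.flatMap fun w => [w ++ [false], w ++ [true]]).filter
        fun w => acc (q.1.1, q.1.1.length + x.1 + 1, w)) :=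
    hclip.comp (hb.comp Computable.fst) (computable_filter hchildren hacc₁)
  refine (Computable.nat_rec (f := fun q : (List Bool × ℕ) × ℕ => q.2) Computable.snd hbase
    hstep).of_eq fun q => ?_
  obtain ⟨⟨p, b⟩, j⟩ := q
  induction j with
  | zero => rfl
  | succ j ih => rw [clippedTree_succ, ← ih]

/-- The right `p` and `b` for a given `S` need not be computable, so the index runs over all pairs.
Clipping makes even the wrong guesses weak constructors. -/
theorem weaklyComputablyCountable_of_clippedTree {X : Set (ℕ → Bool)}
    {acc : List Bool → ℕ → List Bool → Bool}
    (hacc : Computable fun q : List Bool × ℕ × List Bool => acc q.1 q.2.1 q.2.2)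
    (hX : ∀ S ∈ X, ∃ (p : List Bool) (b : ℕ), (∀ n, p.length ≤ n → acc p n (initSeg S n) = true) ∧
      ∀ n, p.length ≤ n → ((strs n).filter (acc p n)).length ≤ b) :
    WeaklyComputablyCountable X := by
  let par : ℕ → List Bool × ℕ := fun k =>
    (((decode k.unpair.1 : Option (List Bool))).getD [], k.unpair.2)
  have hpar : Computable par := by
    refine Computable.pair (Computable.option_getD (Computable.decode.comp
      (Computable.fst.comp Computable.unpair)) (Computable.const [])) ?_
    exact Computable.snd.comp Computable.unpair
  refine ⟨fun k j => (clippedTree (acc (par k).1) (par k).1.length (par k).2 j).toFinset,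
    ⟨_, (computable_clippedTree (acc := fun q => acc q.1 q.2.1 q.2.2) hacc).comp (Computable.pair (hpar.comp Computable.fst)
      Computable.snd), fun k j => rfl⟩, fun k => isWeakConstructor_clippedTree _ _ _,
    fun S hS => ?_⟩
  obtain ⟨p, b, h1, h2⟩ := hX S hS
  refine Set.mem_iUnion.2 ⟨Nat.pair (encode p) b, ?_⟩
  have : par (Nat.pair (encode p) b) = (p, b) := by simp [par]
  simp only [this]
  exact mem_weakResult_clippedTree h1 h2

/-! ### Strings on which a supermartingale has capital -/

theorem length_filter_mul_le {α : Type*} {f : α → ℝ} {q : α → Bool} {c : ℝ} (l : List α)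
    (h0 : ∀ w ∈ l, 0 ≤ f w) (hq : ∀ w ∈ l, q w = true → c ≤ f w) :
    ((l.filter q).length : ℝ) * c ≤ (l.map f).sum := by
  induction l with
  | nil => simp
  | cons a l ih =>
    have ih' := ih (fun w hw => h0 w (List.mem_cons_of_mem a hw))
      fun w hw => hq w (List.mem_cons_of_mem a hw)
    have ha := h0 a List.mem_cons_self
    rw [List.map_cons, List.sum_cons]
    cases h : q a
    · rw [List.filter_cons_of_neg (by simp [h])]
      linarith
    · have := hq a List.mem_cons_self h
      rw [List.filter_cons_of_pos h, List.length_cons]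
      push_cast
      linarith

/-- Markov's inequality: each accepted string contributes at least `1 / 2 / 2 ^ p.length` to a sum
bounded by `d []`. -/
theorem length_filter_le_of_isSupermartingale {p : List Bool} {n : ℕ} (hn : p.length ≤ n)
    {d : List Bool → ℝ} (hd : IsSupermartingale (bitOdds (condBit p n)) d) {q : List Bool → Bool}
    (hq : ∀ w, q w = true → 1 / 2 ≤ d w) :
    (((strs n).filter q).length : ℝ) ≤ d [] * (2 * 2 ^ p.length) := by
  have hP : ∀ w, (0 : ℝ) < oddsProd (bitOdds (condBit p n)) w := fun w => by
    exact_mod_cast oddsProd_pos (one_le_bitOdds _) w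
  have h := length_filter_mul_le (f := fun w => d w / oddsProd (bitOdds (condBit p n)) w)
    (q := q) (c := 1 / 2 / 2 ^ p.length) (strs n)
    (fun w _ => div_nonneg (hd.1 w) (hP w).le) (fun w hw hqw => by
      refine div_le_div₀ (hd.1 w) (hq w hqw) (hP w) ?_
      exact_mod_cast oddsProd_condBit_le hn (mem_strs.1 hw))
  have h' := h.trans (hd.sum_le (one_le_bitOdds _) n)
  rw [div_div, mul_one_div, div_le_iff₀ (by positivity)] at h'
  exact h'

/-! ### Conditions that force capital along a sequence -/

theorem exists_extends_of_condLe {p : ℕ → List Bool} (hle : ∀ j, CondLe (p j) (p (j + 1)))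
    (hlt : ∀ j, (p j).length < (p (j + 1)).length) : ∃ B, ∀ j, Extends (p j) B := by
  have hmono : ∀ i j, i ≤ j → CondLe (p i) (p j) := by
    intro i j hij
    induction j, hij using Nat.le_induction with
    | base => exact CondLe.refl _
    | succ j _ ih => exact ih.trans (hle j)
  have hlen : ∀ j, j ≤ (p j).length := fun j => (strictMono_nat_of_lt_succ hlt).id_le j
  -- The lengths increase strictly, so the condition numbered `encode w + 1` already decides `w`.
  refine ⟨fun w => ((p (encode w + 1))[encode w]?).getD false, fun j w hw => ?_⟩
  have h1 : encode w < (p (encode w + 1)).length := hlen (encode w + 1)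
  have h2 : (p (encode w + 1))[encode w]? = (p j)[encode w]? :=
    ((hmono _ _ (le_max_left _ j)).2 w h1).symm.trans ((hmono _ _ (le_max_right _ j)).2 w hw)
  simp [h2, hw]

/-- If a condition forces bounds of the supermartingale arbitrarily far along `S`, then it does
not succeed strongly on `S` for some acceptable odds function. -/
theorem exists_not_succeedsStrongly {F : AcceptableOdds → List Bool → ℝ} {S : ℕ → Bool}
    (G : List Bool → Prop) (hG : ∃ p, G p)
    (hstep : ∀ p, G p → ∃ q, G q ∧ CondLe p q ∧ p.length < q.length ∧
      (∃ n, p.length ≤ n ∧ ∀ B (hB : FrequentlyFull B), Extends q B →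
        F (ofBits B hB) (initSeg S n) ≤ 2) ∧
      ∃ l, p.length ≤ l ∧ ∀ B, Extends q B → ∀ w : List Bool, w.length = l → B w = true) :
    ∃ O, ¬ SucceedsStrongly (F O) S := by
  obtain ⟨p₀, hp₀⟩ := hG
  choose! next h1 h2 h3 h4 h5 using hstep
  let p : ℕ → List Bool := fun j => Nat.rec p₀ (fun _ => next) j
  have hp : ∀ j, G (p j) := fun j => Nat.rec hp₀ (fun j ih => h1 _ ih) j
  have hlt : ∀ j, (p j).length < (p (j + 1)).length := fun j => h3 _ (hp j)
  have hlen : ∀ j, j ≤ (p j).length := fun j => (strictMono_nat_of_lt_succ hlt).id_le j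
  obtain ⟨B, hB⟩ := exists_extends_of_condLe (fun j => h2 _ (hp j)) hlt
  have hfull : FrequentlyFull B := fun m => by
    obtain ⟨l, hl, h⟩ := h5 _ (hp m)
    exact ⟨l, (hlen m).trans hl, h B (hB (m + 1))⟩
  refine ⟨ofBits B hfull, fun hS => ?_⟩
  -- Any constant above the forced bound 2 would do.
  obtain ⟨m, hm⟩ := Filter.eventually_atTop.1 (succeedsStrongly_iff.1 hS 3)
  obtain ⟨n, hn, h⟩ := h4 _ (hp m)
  have := hm n ((hlen m).trans hn)
  have := h B hfull (hB (m + 1))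
  linarith

theorem WeaklyComputablyCountable.of_hasComputableSPDZ {X : Set (ℕ → Bool)}
    (h : HasComputableSPDZ X) : WeaklyComputablyCountable X := by
  obtain ⟨F, ⟨M, hM⟩, hF⟩ := h
  have hrun : ∀ B (hB : FrequentlyFull B) (r : ℕ) (w : List Bool),
      ∃ m ∈ M.run (bitOracle B) (Nat.pair r (encode w)),
        |(ratOfCode m : ℝ) - F (ofBits B hB) w| ≤ (1 / 2 : ℝ) ^ r := by
    intro B hB r w
    rw [← oracle_ofBits B hB]
    exact hM (ofBits B hB) r w
  have hdet : ∀ {B} (hB : FrequentlyFull B) {r m : ℕ} {w : List Bool},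
      m ∈ M.run (bitOracle B) (Nat.pair r (encode w)) →
        |(ratOfCode m : ℝ) - F (ofBits B hB) w| ≤ (1 / 2 : ℝ) ^ r := by
    intro B hB r m w hm
    obtain ⟨m', hm', h⟩ := hrun B hB r w
    rwa [Part.mem_unique hm hm']
  -- Precision 1 means error at most `1 / 2`: an output at least 1 gives capital at least `1 / 2`,
  -- and an output below 1 gives capital below 2.
  choose out hout hout' using fun (p : List Bool) (n : ℕ) (w : List Bool) =>
    hrun (condBit p n) (frequentlyFull_condBit p n) 1 w
  have hcomp : Computable fun q : List Bool × ℕ × List Bool => out q.1 q.2.1 q.2.2 := by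
    refine Partrec.of_eq_tot ((OracleProgram.partrec_run computable_bitOracle_condBit M).comp
      (g := fun q : List Bool × ℕ × List Bool => (q.1, q.2.1))
      (h := fun q => Nat.pair 1 (encode q.2.2)) ?_ ?_) fun q => hout q.1 q.2.1 q.2.2
    · exact Computable.pair Computable.fst (Computable.fst.comp Computable.snd)
    · exact Primrec₂.natPair.to_comp.comp (Computable.const 1)
        (Computable.encode.comp (Computable.snd.comp Computable.snd))
  let acc : List Bool → ℕ → List Bool → Bool := fun p n w =>
    decide ((out p n w).unpair.2 < (out p n w).unpair.1)
  have hacc : ∀ p n w, acc p n w = true ↔ 1 ≤ ratOfCode (out p n w) := by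
    intro p n w
    rw [ratOfCode, one_le_div (by positivity), decide_eq_true_iff]
    exact_mod_cast Iff.rfl
  refine weaklyComputablyCountable_of_clippedTree (acc := acc) ?_ fun S hS => ?_
  · have hlt : Computable₂ fun a b : ℕ => decide (a < b) := Primrec.nat_lt.decide.to_comp
    exact hlt.comp (Computable.snd.comp (Computable.unpair.comp hcomp))
      (Computable.fst.comp (Computable.unpair.comp hcomp))
  have hfull₀ : FrequentlyFull fun _ => true := fun m => ⟨m, le_rfl, fun _ _ => rfl⟩
  -- The use of this one computation gives a condition `p₀` under which the initial capital has a
  -- single bound for all acceptable bit odds extending it.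
  obtain ⟨m₀, hm₀, -⟩ := hrun _ hfull₀ 0 []
  obtain ⟨s₀, hs₀⟩ := mem_run_bitOracle_of_agree M hm₀
  set p₀ := restrictBits (fun _ => true) s₀ with hp₀
  have hinit : ∀ B (hB : FrequentlyFull B), Extends p₀ B →
      F (ofBits B hB) [] ≤ ratOfCode m₀ + 1 := by
    intro B hB hext
    have := hdet hB (hs₀ B fun w hw => hext.eq_of_restrictBits hw)
    rw [pow_zero] at this
    linarith [(abs_le.1 this).1]
  obtain ⟨p, hp, hpacc⟩ : ∃ p, CondLe p₀ p ∧
      ∀ n, p.length ≤ n → acc p n (initSeg S n) = true := by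
    by_contra! hcon
    obtain ⟨O, hO⟩ := exists_not_succeedsStrongly (F := F) (S := S) (CondLe p₀)
      ⟨p₀, CondLe.refl _⟩ (by
        intro p hp
        obtain ⟨n, hn, hnacc⟩ := hcon p hp
        obtain ⟨s, hs⟩ := mem_run_bitOracle_of_agree M (hout p n (initSeg S n))
        -- Length `t` covers `p`, the use `s` of the rejecting computation, and every string of
        -- length `n + 1`, where the bits of `condBit p n` are `true`. The last point keeps the
        -- limit odds acceptable.
        set t := p.length + s + (strs (n + 1)).toFinset.sup encode + 1 with ht
        have hpq : CondLe p (restrictBits (condBit p n) t) :=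
          condLe_restrictBits (extends_condBit p n) (by omega)
        refine ⟨restrictBits (condBit p n) t, hp.trans hpq, hpq, by rw [length_restrictBits]; omega,
          ⟨n, hn, fun B hB hext => ?_⟩, ⟨n + 1, by omega, fun B hext w hw => ?_⟩⟩
        · have hm := hdet hB (hs B fun w hw => hext.eq_of_restrictBits (by omega))
          have hlt : (ratOfCode (out p n (initSeg S n)) : ℝ) < 1 := by
            rw [Ne, hacc, not_le] at hnacc
            exact_mod_cast hnacc
          rw [pow_one] at hm
          linarith [(abs_le.1 hm).1]
        · have : encode w ≤ (strs (n + 1)).toFinset.sup encode :=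
            Finset.le_sup (f := encode) (List.mem_toFinset.2 (mem_strs.2 hw))
          rw [hext.eq_of_restrictBits (by omega), condBit_of_le_length n (by omega),
            decide_eq_true_iff]
          omega)
    exact hO ((hF O).2 S hS)
  refine ⟨p, ⌊((ratOfCode m₀ : ℝ) + 1) * (2 * 2 ^ p.length)⌋₊, hpacc, fun n hn => ?_⟩
  refine Nat.le_floor ((length_filter_le_of_isSupermartingale hn
    (hF (ofBits _ (frequentlyFull_condBit p n))).1 fun w hw => ?_).trans ?_)
  · have h1 : (1 : ℝ) ≤ ratOfCode (out p n w) := by exact_mod_cast (hacc p n w).1 hw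
    have h2 := hout' p n w
    rw [pow_one] at h2
    linarith [(abs_le.1 h2).2]
  · exact mul_le_mul_of_nonneg_right (hinit _ _ ((extends_condBit p n).of_condLe hp))
      (by positivity)

end StrongPacking

theorem mainTheorem3 (X : Set (ℕ → Bool)) :
    StrongPacking.HasComputableSPDZ X ↔ StrongPacking.WeaklyComputablyCountable X :=
  ⟨StrongPacking.WeaklyComputablyCountable.of_hasComputableSPDZ,
    StrongPacking.HasComputableSPDZ.of_weaklyComputablyCountable⟩
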